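/- Let $S$ be a locally compact Hausdorff space with countable base, $S^\Delta$ its one-point compactification ($S\sqcup\{\Delta\}$ with $\Delta$ isolated if $S$ is compact), and let $d$ be any metric inducing the topology of $S$. Let $\mathbb{D}_{\mathrm{loc}}(S)$ be the set of all $x:[0,\xi(x))\to S$ with $0\le \xi(x)\le\infty$ that are right-continuous on $[0,\xi(x))$, have left limits in $S$ on $(0,\xi(x))$, and have a left limit in $S$ at $\xi(x)$ whenever $0<\xi(x)<\infty$ and $\{x_s\}_{s<\xi(x)}$ is relatively compact in $S$; set $x_t:=\Delta$ for $t\ge\xi(x)$. Let $\widetilde\Lambda$ be the set of increasing bijections $\lambda:\mathbb{R}_+\to\mathbb{R}_+$ and $\Lambda\subset\widetilde\Lambda$ the set of those $\lambda$ for which $\lambda$ and $\lambda^{-1}$ are locally Lipschitz; put $$\|\lambda-\mathrm{id}\|_t:=\sup_{0\le s\le t}|\lambda_s-s|\quad(\lambda\in\widetilde\Lambda),\qquad \|\log\dot\lambda\|_t:=\sup_{0\le s_1<s_2\le t}\left|\log\frac{\lambda_{s_2}-\lambda_{s_1}}{s_2-s_1}\right|\quad(\lambda\in\Lambda).$$ For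 $M\subset\widetilde\Lambda$ and a functional $N_t$ on $M$, consider, for a sequence $(x^k)_k$ and a point $x$ in $\mathbb{D}_{\mathrm{loc}}(S)$, the condition $C(M,N)$: there exists a sequence $(\lambda^k)_k$ in $M$ such that - either $\xi(x)<\infty$ and $\{x_s\}_{s<\xi(x)}$ is relatively compact in $S$, $\lambda^k_{\xi(x)}\le\xi(x^k)$ for $k$ large enough, and as $k\to\infty$: $\sup_{s<\xi(x)}d(x_s,x^k_{\lambda^k_s})\to0$, $x^k_{\lambda^k_{\xi(x)}}\to\Delta$ in $S^\Delta$, and $N_{\xi(x)}(\lambda^k)\to0$; - or $\xi(x)=\infty$ or $\{x_s\}_{s<\xi(x)}$ is not relatively compact in $S$, and for all $t<\xi(x)$: $\lambda^k_t<\xi(x^k)$ for $k$ large enough, and as $k\to\infty$: $\sup_{s\le t}d(x_s,x^k_{\lambda^k_s})\to0$ and $N_t(\lambda^k)\to0$. The local Skorokhod topology on $\mathbb{D}_{\mathrm{loc}}(S)$ is the unique Polish topology whose convergent sequences $x^k\to x$ are those satisfying $C(\Lambda,\|\log\dot\lambda\|)$; its open sets are the sets $U$ such that every sequence satisfying $C(\Lambda,\|\log\dot\lambda\|)$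 with a limit $x\in U$ is eventually in $U$. It does not depend on the choice of $d$. **Theorem.** The local Skorokhod topology is also described by the similar criterion with $\Lambda$ and $\|\log\dot\lambda\|$ replaced by $\widetilde\Lambda$ and $\|\lambda-\mathrm{id}\|$: for all $x$ and $(x^k)_k$ in $\mathbb{D}_{\mathrm{loc}}(S)$, convergence $x^k\to x$ in the local Skorokhod topology is equivalent to $C(\Lambda,\|\log\dot\lambda\|)$ and is equivalent to $C(\widetilde\Lambda,\|\lambda-\mathrm{id}\|)$; and a Polish topology on $\mathbb{D}_{\mathrm{loc}}(S)$ whose convergent sequences are exactly those satisfying $C(\widetilde\Lambda,\|\lambda-\mathrm{id}\|)$ is the local Skorokhod topology. -/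

import Mathlib

open Set Filter Topology
open scoped NNReal ENNReal

namespace LocalSkorokhod

/-- An exploding cadlag path `x : [0, ξ) → S` with `0 ≤ ξ ≤ ∞`, viewed as an element of
`(S^Δ)^{ℝ₊}` by setting `x t = Δ` for `t ≥ ξ`. Here `S^Δ = OnePoint S` (for compact `S` the added
point is isolated). -/
@[ext]
structure ExpPath (S : Type*) [TopologicalSpace S] where
  /-- the explosion time `ξ(x)` -/
  xi : ℝ≥0∞
  /-- the value `x t ∈ S^Δ` -/
  val : ℝ≥0 → OnePoint S
  val_eq_infty_iff : ∀ t : ℝ≥0, val t = OnePoint.infty ↔ xi ≤ (t : ℝ≥0∞)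
  right_continuous : ∀ t : ℝ≥0, (t : ℝ≥0∞) < xi → Tendsto val (𝓝[>] t) (𝓝 (val t))
  left_limit : ∀ t : ℝ≥0, 0 < t → (t : ℝ≥0∞) < xi →
    ∃ a : S, Tendsto val (𝓝[<] t) (𝓝 (a : OnePoint S))

/-- The condition `{x_s}_{s < ξ(x)} ⋐ S`: the range of the path is relatively compact in `S`. -/
def ExpPath.RelCompact {S : Type*} [TopologicalSpace S] (x : ExpPath S) : Prop :=
  IsCompact (closure {a : S | ∃ s : ℝ≥0, (s : ℝ≥0∞) < x.xi ∧ x.val s = (a : OnePoint S)})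

/-- The local cadlag space `𝔻_loc(S)`: if `ξ(x) ∈ (0, ∞)` and the range of `x` is relatively compact
in `S`, then the left limit of `x` at `ξ(x)` exists in `S`. -/
@[ext]
structure LocPath (S : Type*) [TopologicalSpace S] extends ExpPath S where
  left_limit_xi : ∀ T : ℝ≥0, 0 < T → xi = (T : ℝ≥0∞) → toExpPath.RelCompact →
    ∃ a : S, Tendsto val (𝓝[<] T) (𝓝 (a : OnePoint S))

/-- `d` is a metric on `S` that induces the given topology of `S`. -/
def IsMetricOf {S : Type*} [t : TopologicalSpace S] (d : S → S → ℝ) : Prop :=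
  ∃ m : MetricSpace S, m.toUniformSpace.toTopologicalSpace = t ∧ ∀ a b : S, m.dist a b = d a b

/-- The distance `d` between two points of `S ⊂ S^Δ`, as an extended nonnegative number. It is only
meant for points of `S`; if one of the points is `Δ`, the value is `∞` by convention. -/
noncomputable def distS {S : Type*} (d : S → S → ℝ) : OnePoint S → OnePoint S → ℝ≥0∞
  | some a, some b => ENNReal.ofReal (d a b)
  | _, _ => ⊤

/-- The space `Λ̃` of increasing bijections from `ℝ₊` to `ℝ₊`. -/
abbrev TimeChange : Type := ℝ≥0 ≃o ℝ≥0

/-- The set `Λ ⊂ Λ̃` of increasing bijections `l` with `l` and `l⁻¹` locally Lipschitz. -/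
def lipTimeChanges : Set TimeChange :=
  {l | LocallyLipschitz (l : ℝ≥0 → ℝ≥0) ∧ LocallyLipschitz (l.symm : ℝ≥0 → ℝ≥0)}

/-- `‖l - id‖_t = sup_{0 ≤ s ≤ t} |l_s - s|`. -/
noncomputable def supNorm (l : TimeChange) (t : ℝ≥0) : ℝ≥0∞ :=
  ⨆ (s : ℝ≥0) (_ : s ≤ t), ENNReal.ofReal |(l s : ℝ) - (s : ℝ)|

/-- `‖log l̇‖_t = sup_{0 ≤ s₁ < s₂ ≤ t} |log ((l_{s₂} - l_{s₁}) / (s₂ - s₁))|`. -/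
noncomputable def logNorm (l : TimeChange) (t : ℝ≥0) : ℝ≥0∞ :=
  ⨆ (s₁ : ℝ≥0) (s₂ : ℝ≥0) (_ : s₁ < s₂) (_ : s₂ ≤ t),
    ENNReal.ofReal |Real.log (((l s₂ : ℝ) - (l s₁ : ℝ)) / ((s₂ : ℝ) - (s₁ : ℝ)))|

/-- The convergence criterion for a sequence `x^k` and a limit `x` in `𝔻_loc(S)`, with time changes
`l^k` taken in the set `A` and measured by `N l t`. -/
def Criterion {S : Type*} [TopologicalSpace S] (d : S → S → ℝ) (A : Set TimeChange)
    (N : TimeChange → ℝ≥0 → ℝ≥0∞) (x : LocPath S) (xk : ℕ → LocPath S) : Prop :=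
  ∃ l : ℕ → TimeChange, (∀ k, l k ∈ A) ∧
    ((∃ T : ℝ≥0, x.xi = (T : ℝ≥0∞) ∧ x.RelCompact ∧
        (∀ᶠ k in atTop, ((l k T : ℝ≥0) : ℝ≥0∞) ≤ (xk k).xi) ∧
        Tendsto (fun k => ⨆ (s : ℝ≥0) (_ : (s : ℝ≥0∞) < x.xi),
          distS d (x.val s) ((xk k).val (l k s))) atTop (𝓝 0) ∧
        Tendsto (fun k => (xk k).val (l k T)) atTop (𝓝 OnePoint.infty) ∧
        Tendsto (fun k => N (l k) T) atTop (𝓝 0)) ∨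
      ((x.xi = ⊤ ∨ ¬ x.RelCompact) ∧
        ∀ t : ℝ≥0, (t : ℝ≥0∞) < x.xi →
          (∀ᶠ k in atTop, ((l k t : ℝ≥0) : ℝ≥0∞) < (xk k).xi) ∧
          Tendsto (fun k => ⨆ (s : ℝ≥0) (_ : s ≤ t),
            distS d (x.val s) ((xk k).val (l k s))) atTop (𝓝 0) ∧
          Tendsto (fun k => N (l k) t) atTop (𝓝 0)))

/-- The criterion that defines the local Skorokhod topology: `l^k ∈ Λ` and `‖log l̇^k‖`. -/
def LogCriterion {S : Type*} [TopologicalSpace S] (d : S → S → ℝ) (x : LocPath S)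
    (xk : ℕ → LocPath S) : Prop :=
  Criterion d lipTimeChanges logNorm x xk

/-- The similar criterion with `l^k ∈ Λ̃` and `‖l^k - id‖`. -/
def SupCriterion {S : Type*} [TopologicalSpace S] (d : S → S → ℝ) (x : LocPath S)
    (xk : ℕ → LocPath S) : Prop :=
  Criterion d univ supNorm x xk

/-- The local Skorokhod topology on `𝔻_loc(S)`: a set `U` is open iff every sequence that converges
to a point of `U` in the sense of `LogCriterion` is eventually in `U`. By
`eq_localSkorokhodTopology` below, a Polish topology whose convergent sequences are exactly those
described by `LogCriterion` is necessarily this topology. -/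
abbrev localSkorokhodTopology {S : Type*} [TopologicalSpace S] (d : S → S → ℝ) :
    TopologicalSpace (LocPath S) where
  IsOpen U := ∀ x ∈ U, ∀ xk : ℕ → LocPath S, LogCriterion d x xk → ∀ᶠ k in atTop, xk k ∈ U
  isOpen_univ := fun _ _ _ _ => Eventually.of_forall fun _ => mem_univ _
  isOpen_inter := fun _ _ hU hV x hx xk h => (hU x hx.1 xk h).and (hV x hx.2 xk h)
  isOpen_sUnion := fun _ hs x ⟨U, hU, hx⟩ xk h =>
    (hs U hU x hx xk h).mono fun _ hk => ⟨U, hU, hk⟩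

/-- A Polish topology on `𝔻_loc(S)` whose convergent sequences are exactly those described by
`LogCriterion` is the local Skorokhod topology. -/
theorem eq_localSkorokhodTopology {S : Type*} [TopologicalSpace S] (d : S → S → ℝ)
    (τ : TopologicalSpace (LocPath S)) (hτ : @PolishSpace (LocPath S) τ)
    (h : ∀ (x : LocPath S) (xk : ℕ → LocPath S),
      Tendsto xk atTop (@nhds (LocPath S) τ x) ↔ LogCriterion d x xk) :
    τ = localSkorokhodTopology d := by
  refine TopologicalSpace.ext_iff_isClosed.2 fun F => ?_
  rw [← @isOpen_compl_iff _ _ (localSkorokhodTopology d)]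
  constructor
  · intro hF x hx xk hk
    have hopen : IsOpen Fᶜ := hF.isOpen_compl
    exact ((h x xk).2 hk) (hopen.mem_nhds hx)
  · intro hF
    refine IsSeqClosed.isClosed fun xk x hxk hx => ?_
    by_contra hxF
    obtain ⟨k, hk⟩ := (hF x hxF xk ((h x xk).1 hx)).exists
    exact hk (hxk k)

end LocalSkorokhod

/-! The two criteria agree because a cadlag path on `[0, T]` has only finitely many oscillations
larger than a given `ε`. Cut the interval at a finite set `F` such that `x` oscillates by at most
`ε` on each piece (`IsCadlagOn.exists_finset`). If `l` is uniformly close to the identity, some `m`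
agrees with `l` on `F` and at `T` and has slopes close to `1` (`exists_lipTimeChange_eqOn`). Then
`l⁻¹ ∘ m` maps each piece to itself, so `x ∘ l⁻¹ ∘ m` is close to `x`; if `y ∘ l` is close to `x`,
then so is `y ∘ m = (y ∘ l) ∘ (l⁻¹ ∘ m)`. Conversely, slopes close to `1` and `l 0 = 0` give a small
displacement on bounded intervals.

A diagonal choice of time changes turns each criterion into convergence along a filter attached to
`x` (`criterion_iff_tendsto`), so the comparison concerns one path and one time change at a time.

The topology is defined through its sequentially open sets, so it could have more convergent
sequences than the criterion. It has none, by `tendsto_nhds_sequential_iff`, since constant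
sequences converge and limits are unique. Uniqueness (`SupCriterion.unique`) compares two limits
through the time changes `m⁻¹ ∘ l`, which tend to the identity. The metric does not matter because
cadlag paths stay in compact sets, near which any two metrics are uniformly comparable. -/

namespace LocalSkorokhod

/-! ### Sequential topologies with unique limits -/

section SequentialTopology

variable {X : Type*} {n : X → Filter X}

theorem eq_of_frequently_eq (hpure : ∀ x, pure x ≤ n x)
    (huniq : ∀ (u : ℕ → X) (x y : X), Tendsto u atTop (n x) → Tendsto u atTop (n y) → x = y)
    {u : ℕ → X} {w e : X} (hu : Tendsto u atTop (n w)) (h : ∃ᶠ k in atTop, u k = e) : w = e := by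
  obtain ⟨φ, hφ, hφe⟩ := extraction_of_frequently_atTop h
  refine huniq (u ∘ φ) w e (hu.comp hφ.tendsto_atTop) ?_
  have : u ∘ φ = fun _ => e := funext hφe
  rw [this]
  exact (tendsto_pure.2 (Eventually.of_forall fun _ => rfl)).mono_right (hpure e)

/-- Suppose `u` meets `range z` infinitely often. Either one term of `z` is hit infinitely often,
and uniqueness makes it equal to `w`, or the indices tend to infinity, and `w` is the limit of a
subsequence of `z`, hence in `E`. -/
theorem eventually_notMem_range_union (hpure : ∀ x, pure x ≤ n x)
    (huniq : ∀ (u : ℕ → X) (x y : X), Tendsto u atTop (n x) → Tendsto u atTop (n y) → x = y)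
    {z : ℕ → X} {E : Set X} (hE : E.Subsingleton)
    (hz : ∀ (w : X) (ψ : ℕ → ℕ), Tendsto ψ atTop atTop → Tendsto (z ∘ ψ) atTop (n w) → w ∈ E)
    {w : X} (hw : w ∈ (range z ∪ E)ᶜ) {u : ℕ → X} (hu : Tendsto u atTop (n w)) :
    ∀ᶠ k in atTop, u k ∈ (range z ∪ E)ᶜ := by
  by_contra hcon
  have hfr : ∃ᶠ k in atTop, u k ∈ range z ∨ u k ∈ E := by
    rw [not_eventually] at hcon
    exact hcon.mono fun k hk => not_not.1 hk
  rcases frequently_or_distrib.1 hfr with h | h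
  · obtain ⟨φ, hφ, hφz⟩ := extraction_of_frequently_atTop h
    choose m hm using hφz
    by_cases hj : ∃ j, ∃ᶠ k in atTop, m k = j
    · obtain ⟨j, hj⟩ := hj
      refine hw (Or.inl ⟨j, (eq_of_frequently_eq hpure huniq (hu.comp hφ.tendsto_atTop)
        (hj.mono fun k hk => ?_)).symm⟩)
      rw [Function.comp_apply, ← hm, hk]
    · have hm' : Tendsto m atTop atTop := by
        rw [← Nat.cofinite_eq_atTop]
        refine le_cofinite_iff_eventually_ne.2 fun j => ?_
        have := not_exists.1 hj j
        rw [not_frequently] at this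
        exact Nat.cofinite_eq_atTop ▸ this
      refine hw (Or.inr (hz w m hm' ?_))
      have : z ∘ m = u ∘ φ := funext hm
      rw [this]
      exact hu.comp hφ.tendsto_atTop
  · obtain ⟨k, hk⟩ := h.exists
    refine hw (Or.inr ?_)
    rw [eq_of_frequently_eq hpure huniq hu (h.mono fun j hj => hE hj hk)]
    exact hk

/-- If the convergence of sequences along the filters `n x` has unique limits, then it is the
convergence of sequences in the sequential topology that it defines. -/
theorem tendsto_nhds_sequential_iff (hpure : ∀ x, pure x ≤ n x)
    (huniq : ∀ (u : ℕ → X) (x y : X), Tendsto u atTop (n x) → Tendsto u atTop (n y) → x = y)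
    (τ : TopologicalSpace X)
    (hτ : ∀ U, IsOpen[τ] U ↔ ∀ x ∈ U, ∀ u : ℕ → X, Tendsto u atTop (n x) →
      ∀ᶠ k in atTop, u k ∈ U) (u : ℕ → X) (x : X) :
    Tendsto u atTop (@nhds X τ x) ↔ Tendsto u atTop (n x) := by
  constructor
  swap
  · intro hu
    refine tendsto_nhds.2 fun U hU hx => (hτ U).1 hU x hx u hu
  intro hu
  refine tendsto_of_subseq_tendsto fun ns hns => ?_
  by_contra hnone
  push Not at hnone
  have hne : ∀ᶠ k in atTop, u (ns k) ≠ x := by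
    by_contra hcon
    rw [not_eventually] at hcon
    obtain ⟨φ, -, hφ⟩ := extraction_of_frequently_atTop hcon
    refine hnone φ ((tendsto_pure.2 (Eventually.of_forall fun k => ?_)).mono_right (hpure x))
    exact not_not.1 (hφ k)
  obtain ⟨N, hN⟩ := eventually_atTop.1 hne
  -- The tail of a subsequence, together with all its possible limits `E`, has an open complement.
  -- This complement contains `x`, although the subsequence tends to `x` for `τ`.
  have key : ∀ (ψ : ℕ → ℕ) (E : Set X), Tendsto ψ atTop atTop → x ∉ E → E.Subsingleton →
      (∀ (w : X) (θ : ℕ → ℕ), Tendsto θ atTop atTop →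
        Tendsto ((fun k => u (ns (ψ k + N))) ∘ θ) atTop (n w) → w ∈ E) → False := by
    intro ψ E hψ hxE hE hz
    have hopen : IsOpen[τ] (range (fun k => u (ns (ψ k + N))) ∪ E)ᶜ :=
      (hτ _).2 fun w hw v hv => eventually_notMem_range_union hpure huniq hE hz hw hv
    have hxU : x ∈ (range (fun k => u (ns (ψ k + N))) ∪ E)ᶜ := by
      rintro (⟨k, hk⟩ | h)
      · exact hN _ (Nat.le_add_left _ _) hk
      · exact hxE h
    have hlim : Tendsto (fun k => u (ns (ψ k + N))) atTop (@nhds X τ x) :=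
      hu.comp (hns.comp ((tendsto_add_atTop_nat N).comp hψ))
    obtain ⟨k, hk⟩ := (hlim.eventually (hopen.mem_nhds hxU)).exists
    exact hk (Or.inl ⟨k, rfl⟩)
  -- Either a further subsequence converges to some `y`, necessarily different from `x`, and `E =
  -- {y}`; or none converges, and `E = ∅`.
  by_cases hex : ∃ (y : X) (ψ : ℕ → ℕ), Tendsto ψ atTop atTop ∧
      Tendsto (fun k => u (ns (ψ k + N))) atTop (n y)
  · obtain ⟨y, ψ, hψ, hy⟩ := hex
    refine key ψ {y} hψ ?_ subsingleton_singleton fun w θ hθ hw => ?_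
    · rintro rfl
      exact hnone (fun k => ψ k + N) hy
    · exact huniq _ _ _ hw (hy.comp hθ)
  · refine key id ∅ tendsto_id (notMem_empty x) subsingleton_empty fun w θ hθ hw => ?_
    exact hex ⟨w, θ, hθ, hw⟩

end SequentialTopology

/-! ### Closeness in `S` and change of metric -/

section Near

variable {S : Type*} {d : S → S → ℝ}

/-- `p` and `q` are points of `S` at distance at most `ε`. -/
def Near (d : S → S → ℝ) (ε : ℝ) (p q : OnePoint S) : Prop :=
  ∃ a b : S, p = a ∧ q = b ∧ d a b ≤ ε

theorem Near.mono {ε ε' : ℝ} {p q : OnePoint S} (h : Near d ε p q) (hε : ε ≤ ε') :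
    Near d ε' p q := by
  obtain ⟨a, b, ha, hb, hab⟩ := h
  exact ⟨a, b, ha, hb, hab.trans hε⟩

theorem distS_le_iff {ε : ℝ} (hε : 0 ≤ ε) {p q : OnePoint S} :
    distS d p q ≤ ENNReal.ofReal ε ↔ Near d ε p q := by
  constructor
  · intro h
    match p, q with
    | some a, some b => exact ⟨a, b, rfl, rfl, (ENNReal.ofReal_le_ofReal_iff hε).1 h⟩
    | none, _ => exact absurd h (by simp [distS])
    | some a, none => exact absurd h (by simp [distS])
  · rintro ⟨a, b, rfl, rfl, hab⟩
    exact ENNReal.ofReal_le_ofReal hab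

theorem Near.metric_mono {d' : S → S → ℝ} {K : Set S} {δ ε : ℝ} (h : ∀ a ∈ K, ∀ b, d a b ≤ δ → d' a b ≤ ε)
    {p q : OnePoint S} (hp : p ∈ ((↑) : S → OnePoint S) '' K) (hpq : Near d δ p q) :
    Near d' ε p q := by
  obtain ⟨a, ha, rfl⟩ := hp
  obtain ⟨a', b, haa, rfl, hab⟩ := hpq
  obtain rfl := OnePoint.coe_injective haa
  exact ⟨a, b, rfl, rfl, h a ha b hab⟩

variable [TopologicalSpace S]

theorem IsMetricOf.self (hd : IsMetricOf d) (a : S) : d a a = 0 := by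
  obtain ⟨m, -, h⟩ := hd
  rw [← h, dist_self]

theorem IsMetricOf.symm (hd : IsMetricOf d) (a b : S) : d a b = d b a := by
  obtain ⟨m, -, h⟩ := hd
  rw [← h, ← h, dist_comm]

theorem IsMetricOf.triangle (hd : IsMetricOf d) (a b c : S) : d a c ≤ d a b + d b c := by
  obtain ⟨m, -, h⟩ := hd
  rw [← h, ← h, ← h]
  exact dist_triangle a b c

theorem IsMetricOf.eq_of_forall_le (hd : IsMetricOf d) {a b : S} (h : ∀ ε > 0, d a b ≤ ε) :
    a = b := by
  obtain ⟨m, -, h'⟩ := hd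
  refine eq_of_dist_eq_zero (le_antisymm (le_of_forall_pos_le_add fun ε hε => ?_) dist_nonneg)
  rw [zero_add, h']
  exact h ε hε

theorem IsMetricOf.nhds_basis (hd : IsMetricOf d) (a : S) :
    (𝓝 a).HasBasis (fun ε : ℝ => 0 < ε) fun ε => {b | d a b < ε} := by
  obtain ⟨m, rfl, h⟩ := hd
  simp only [← h]
  convert Metric.nhds_basis_ball (x := a) using 2 with ε
  ext b
  simp [dist_comm]

theorem Near.symm (hd : IsMetricOf d) {ε : ℝ} {p q : OnePoint S} (h : Near d ε p q) :
    Near d ε q p := by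
  obtain ⟨a, b, ha, hb, hab⟩ := h
  exact ⟨b, a, hb, ha, hd.symm a b ▸ hab⟩

theorem Near.trans (hd : IsMetricOf d) {ε ε' : ℝ} {p q r : OnePoint S} (h : Near d ε p q)
    (h' : Near d ε' q r) : Near d (ε + ε') p r := by
  obtain ⟨a, b, rfl, rfl, hab⟩ := h
  obtain ⟨b', c, hb, rfl, hbc⟩ := h'
  obtain rfl := OnePoint.coe_injective hb
  exact ⟨a, c, rfl, rfl, (hd.triangle a b c).trans (add_le_add hab hbc)⟩

theorem near_self (hd : IsMetricOf d) {ε : ℝ} (hε : 0 ≤ ε) {p : OnePoint S}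
    (hp : p ≠ OnePoint.infty) : Near d ε p p := by
  obtain ⟨a, rfl⟩ := OnePoint.ne_infty_iff_exists.1 hp
  exact ⟨a, a, rfl, rfl, (hd.self a).trans_le hε⟩

theorem eventually_near (hd : IsMetricOf d) (a : S) {ε : ℝ} (hε : 0 < ε) :
    ∀ᶠ p in 𝓝 (a : OnePoint S), Near d ε a p := by
  rw [OnePoint.nhds_coe_eq, eventually_map]
  filter_upwards [(hd.nhds_basis a).mem_of_mem hε] with b hb
  exact ⟨a, b, rfl, rfl, le_of_lt hb⟩

theorem tendsto_ennreal_zero_iff {ι : Type*} {l : Filter ι} {f : ι → ℝ≥0∞} :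
    Tendsto f l (𝓝 0) ↔ ∀ ε : ℝ, 0 < ε → ∀ᶠ k in l, f k ≤ ENNReal.ofReal ε := by
  rw [ENNReal.tendsto_nhds_zero]
  constructor
  · exact fun h ε hε => h _ (ENNReal.ofReal_pos.2 hε)
  · intro h ε hε
    by_cases htop : ε = ⊤
    · simp [htop]
    · have := h ε.toReal (ENNReal.toReal_pos hε.ne' htop)
      rwa [ENNReal.ofReal_toReal htop] at this

/-- A condition that holds near the diagonal point of every `a ∈ K` holds uniformly near `K`. -/
theorem exists_uniform_of_isCompact (hd : IsMetricOf d) {K : Set S} (hK : IsCompact K)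
    {R : S × S → Prop} (hR : ∀ a ∈ K, ∀ᶠ p in 𝓝 (a, a), R p) :
    ∃ δ > 0, ∀ a ∈ K, ∀ b, d a b ≤ δ → R (a, b) := by
  refine hK.induction_on (p := fun A => ∃ δ > 0, ∀ a ∈ A, ∀ b, d a b ≤ δ → R (a, b))
    ⟨1, one_pos, by simp⟩ ?_ ?_ ?_
  · rintro s t hst ⟨δ, hδ, h⟩
    exact ⟨δ, hδ, fun a ha => h a (hst ha)⟩
  · rintro s t ⟨δ, hδ, h⟩ ⟨δ', hδ', h'⟩
    refine ⟨min δ δ', lt_min hδ hδ', ?_⟩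
    rintro a (ha | ha) b hab
    · exact h a ha b (hab.trans (min_le_left _ _))
    · exact h' a ha b (hab.trans (min_le_right _ _))
  · intro a ha
    have := hR a ha
    rw [nhds_prod_eq, ((hd.nhds_basis a).prod_self).eventually_iff] at this
    obtain ⟨r, hr, h⟩ := this
    refine ⟨{b | d a b < r / 2}, mem_nhdsWithin_of_mem_nhds
      ((hd.nhds_basis a).mem_of_mem (half_pos hr)), r / 4, by positivity, fun b hb c hbc => ?_⟩
    have hb' : d a b < r / 2 := hb
    refine h (⟨?_, ?_⟩ : d a b < r ∧ d a c < r)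
    · linarith
    · linarith [hd.triangle a b c]

theorem exists_metric_comparison {d' : S → S → ℝ} (hd : IsMetricOf d) (hd' : IsMetricOf d')
    {K : Set S} (hK : IsCompact K) {ε : ℝ} (hε : 0 < ε) :
    ∃ δ > 0, ∀ a ∈ K, ∀ b, d a b ≤ δ → d' a b ≤ ε := by
  refine exists_uniform_of_isCompact hd hK (R := fun p => d' p.1 p.2 ≤ ε) fun a _ => ?_
  rw [nhds_prod_eq]
  have h := (hd'.nhds_basis a).mem_of_mem (half_pos hε)
  filter_upwards [prod_mem_prod h h] with p hp
  have h1 : d' a p.1 < ε / 2 := hp.1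
  have h2 : d' a p.2 < ε / 2 := hp.2
  linarith [hd'.triangle p.1 a p.2, hd'.symm a p.1]

theorem exists_compact_thickening [LocallyCompactSpace S] (hd : IsMetricOf d) {K : Set S}
    (hK : IsCompact K) :
    ∃ δ > 0, ∃ K' : Set S, IsCompact K' ∧ ∀ a ∈ K, ∀ b, d a b ≤ δ → b ∈ K' := by
  obtain ⟨K', hK', hKK'⟩ := exists_compact_superset hK
  obtain ⟨δ, hδ, h⟩ := exists_uniform_of_isCompact hd hK (R := fun p => p.2 ∈ K') fun a ha =>
    continuous_snd.continuousAt.eventually (mem_interior_iff_mem_nhds.1 (hKK' ha))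
  exact ⟨δ, hδ, K', hK', h⟩

end Near

/-! ### Cadlag functions on bounded intervals -/

section Cadlag

variable {S : Type*} [TopologicalSpace S] {d : S → S → ℝ} {x : ℝ≥0 → OnePoint S} {D : Set ℝ≥0}
  {T : ℝ≥0}

/-- On the part `D` of `[0, T]`, the function `x` has one-sided limits in `S` at each point of
`[0, T]` that `D` accumulates to, and it is right-continuous. -/
structure IsCadlagOn (x : ℝ≥0 → OnePoint S) (D : Set ℝ≥0) (T : ℝ≥0) : Prop where
  le : ∀ s ∈ D, s ≤ T
  left : ∀ t ≤ T, 𝓝[D ∩ Iio t] t = ⊥ ∨ ∃ a : S, Tendsto x (𝓝[D ∩ Iio t] t) (𝓝 (a : OnePoint S))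
  right : ∀ t ≤ T, 𝓝[D ∩ Ici t] t = ⊥ ∨ ∃ a : S, Tendsto x (𝓝[D ∩ Ici t] t) (𝓝 (a : OnePoint S))

theorem nhdsWithin_inter_Iio_sup (D : Set ℝ≥0) (t : ℝ≥0) :
    𝓝[D ∩ Iio t] t ⊔ 𝓝[D ∩ Ici t] t = 𝓝[D] t := by
  rw [← nhdsWithin_union, ← inter_union_distrib_left, Iio_union_Ici, inter_univ]

theorem exists_isCompact_eventually_mem [LocallyCompactSpace S] {f : Filter ℝ≥0}
    (h : f = ⊥ ∨ ∃ a : S, Tendsto x f (𝓝 (a : OnePoint S))) :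
    ∃ K : Set S, IsCompact K ∧ ∀ᶠ s in f, x s ∈ ((↑) : S → OnePoint S) '' K := by
  rcases h with rfl | ⟨a, ha⟩
  · exact ⟨∅, isCompact_empty, eventually_bot⟩
  · obtain ⟨K, hK, haK⟩ := exists_compact_mem_nhds a
    refine ⟨K, hK, ha.eventually ?_⟩
    rw [OnePoint.nhds_coe_eq]
    exact image_mem_map haK

theorem exists_mem_forall_near (hd : IsMetricOf d) {f : Filter ℝ≥0}
    (h : f = ⊥ ∨ ∃ a : S, Tendsto x f (𝓝 (a : OnePoint S))) {ε : ℝ} (hε : 0 < ε) :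
    ∃ W ∈ f, ∀ s ∈ W, ∀ s' ∈ W, Near d ε (x s) (x s') := by
  rcases h with rfl | ⟨a, ha⟩
  · exact ⟨∅, mem_bot, by simp⟩
  · refine ⟨_, ha.eventually (eventually_near hd a (half_pos hε)), fun s hs s' hs' => ?_⟩
    exact ((Near.symm hd hs).trans hd hs').mono (by linarith)

/-- Near each time, the values on either side lie in a compact neighbourhood of the one-sided limit;
finitely many times suffice. -/
theorem IsCadlagOn.exists_isCompact [LocallyCompactSpace S] (hx : IsCadlagOn x D T) :
    ∃ K : Set S, IsCompact K ∧ ∀ s ∈ D, x s ∈ ((↑) : S → OnePoint S) '' K := by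
  have key := (isCompact_Icc (a := (0 : ℝ≥0)) (b := T)).induction_on
    (p := fun A => ∃ K : Set S, IsCompact K ∧ ∀ s ∈ A, s ∈ D → x s ∈ ((↑) : S → OnePoint S) '' K)
    ⟨∅, isCompact_empty, by simp⟩ ?_ ?_ ?_
  · obtain ⟨K, hK, h⟩ := key
    exact ⟨K, hK, fun s hs => h s ⟨zero_le, hx.le s hs⟩ hs⟩
  · rintro s t hst ⟨K, hK, h⟩
    exact ⟨K, hK, fun a ha => h a (hst ha)⟩
  · rintro s t ⟨K, hK, h⟩ ⟨K', hK', h'⟩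
    refine ⟨K ∪ K', hK.union hK', ?_⟩
    rintro a (ha | ha) haD
    · exact image_mono subset_union_left (h a ha haD)
    · exact image_mono subset_union_right (h' a ha haD)
  · rintro t ⟨-, ht⟩
    obtain ⟨K, hK, h⟩ := exists_isCompact_eventually_mem (hx.left t ht)
    obtain ⟨K', hK', h'⟩ := exists_isCompact_eventually_mem (hx.right t ht)
    have : ∀ᶠ s in 𝓝[D] t, x s ∈ ((↑) : S → OnePoint S) '' (K ∪ K') := by
      rw [← nhdsWithin_inter_Iio_sup, eventually_sup]
      exact ⟨h.mono fun s hs => image_mono subset_union_left hs,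
        h'.mono fun s hs => image_mono subset_union_right hs⟩
    exact ⟨_, mem_nhdsWithin_of_mem_nhds (eventually_nhdsWithin_iff.1 this), K ∪ K', hK.union hK',
      fun s hs => hs⟩

/-- A cadlag path oscillates by at most `ε` between the points of a suitable finite set. -/
theorem IsCadlagOn.exists_finset (hd : IsMetricOf d) (hx : IsCadlagOn x D T) {ε : ℝ}
    (hε : 0 < ε) :
    ∃ F : Finset ℝ≥0, ∀ s ∈ D, ∀ s' ∈ D, (∀ p ∈ F, p ≤ s ↔ p ≤ s') → Near d ε (x s) (x s') := by
  have key := (isCompact_Icc (a := (0 : ℝ≥0)) (b := T)).induction_on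
    (p := fun A => ∃ F : Finset ℝ≥0, ∀ s ∈ A, s ∈ D → ∀ s' ∈ D, (∀ p ∈ F, p ≤ s ↔ p ≤ s') →
      Near d ε (x s) (x s'))
    ⟨∅, by simp⟩ ?_ ?_ ?_
  · obtain ⟨F, h⟩ := key
    exact ⟨F, fun s hs => h s ⟨zero_le, hx.le s hs⟩ hs⟩
  · rintro s t hst ⟨F, h⟩
    exact ⟨F, fun a ha => h a (hst ha)⟩
  · classical
    rintro s t ⟨F, h⟩ ⟨F', h'⟩
    refine ⟨F ∪ F', ?_⟩
    rintro a (ha | ha) haD s' hs' hF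
    · exact h a ha haD s' hs' fun p hp => hF p (Finset.mem_union_left _ hp)
    · exact h' a ha haD s' hs' fun p hp => hF p (Finset.mem_union_right _ hp)
  · rintro t ⟨-, ht⟩
    obtain ⟨W, hW, h⟩ := exists_mem_forall_near hd (hx.left t ht) hε
    obtain ⟨W', hW', h'⟩ := exists_mem_forall_near hd (hx.right t ht) hε
    rw [mem_nhdsWithin_iff_eventually] at hW hW'
    obtain ⟨r, hr, hball⟩ := Metric.eventually_nhds_iff.1 (hW.and hW')
    lift r to ℝ≥0 using hr.le
    have hr' : (0 : ℝ≥0) < r := by exact_mod_cast hr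
    -- The points `t ± r / 2` confine `s'` to the ball of radius `r`, and `t` puts `s` and `s'` on
    -- the same side of the possible jump.
    refine ⟨Metric.ball t (r / 2), mem_nhdsWithin_of_mem_nhds
      (Metric.ball_mem_nhds t (half_pos hr)), {t - r / 2, t, t + r / 2}, fun s hs hsD s' hs' hF => ?_⟩
    have h1 := hF (t - r / 2) (by simp)
    have h2 := hF t (by simp)
    have h3 := hF (t + r / 2) (by simp)
    rw [Metric.mem_ball, NNReal.dist_eq, abs_lt] at hs
    have hs1 : t - r / 2 ≤ s := by
      rw [tsub_le_iff_right, ← NNReal.coe_le_coe]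
      push_cast
      linarith
    have hs3 : ¬ t + r / 2 ≤ s := by
      rw [← NNReal.coe_le_coe]
      push_cast
      linarith
    have hs1' := h1.1 hs1
    have hs3' : ¬ t + r / 2 ≤ s' := fun h => hs3 (h3.2 h)
    rw [tsub_le_iff_right, ← NNReal.coe_le_coe] at hs1'
    rw [not_le, ← NNReal.coe_lt_coe] at hs3'
    push_cast at hs1' hs3'
    have hsb := @hball s (by rw [NNReal.dist_eq, abs_lt]; constructor <;> linarith)
    have hsb' := @hball s' (by rw [NNReal.dist_eq, abs_lt]; constructor <;> linarith)
    rcases lt_or_ge s t with hlt | hge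
    · have hlt' : s' < t := lt_of_not_ge fun hc => not_le.2 hlt (h2.2 hc)
      exact h s (hsb.1 ⟨hsD, hlt⟩) s' (hsb'.1 ⟨hs', hlt'⟩)
    · exact h' s (hsb.2 ⟨hsD, hge⟩) s' (hsb'.2 ⟨hs', h2.1 hge⟩)

end Cadlag

/-! ### Time changes with slopes close to one -/

section TimeChange

theorem supNorm_le_iff {l : TimeChange} {t : ℝ≥0} {ε : ℝ} (hε : 0 ≤ ε) :
    supNorm l t ≤ ENNReal.ofReal ε ↔ ∀ s ≤ t, |(l s : ℝ) - s| ≤ ε := by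
  simp only [supNorm, iSup_le_iff, ENNReal.ofReal_le_ofReal_iff hε]

theorem logNorm_le_iff {l : TimeChange} {t : ℝ≥0} {ε : ℝ} (hε : 0 ≤ ε) :
    logNorm l t ≤ ENNReal.ofReal ε ↔ ∀ s₁ s₂ : ℝ≥0, s₁ < s₂ → s₂ ≤ t →
      |Real.log (((l s₂ : ℝ) - (l s₁ : ℝ)) / ((s₂ : ℝ) - (s₁ : ℝ)))| ≤ ε := by
  simp only [logNorm, iSup_le_iff, ENNReal.ofReal_le_ofReal_iff hε]

theorem supNorm_mono (l : TimeChange) : Monotone (supNorm l) := fun _ _ h =>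
  iSup_mono fun _ => iSup_mono' fun hs => ⟨hs.trans h, le_rfl⟩

theorem logNorm_mono (l : TimeChange) : Monotone (logNorm l) := fun _ _ h =>
  iSup_mono fun _ => iSup_mono fun _ => iSup_mono fun _ => iSup_mono' fun hs =>
    ⟨hs.trans h, le_rfl⟩

theorem refl_mem_lipTimeChanges : OrderIso.refl ℝ≥0 ∈ lipTimeChanges :=
  ⟨LocallyLipschitz.id, LocallyLipschitz.id⟩

theorem logNorm_refl (t : ℝ≥0) : logNorm (OrderIso.refl ℝ≥0) t = 0 := by
  simp only [logNorm, OrderIso.refl_apply, ENNReal.iSup_eq_zero, ENNReal.ofReal_eq_zero]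
  intro s₁ s₂ h _
  rw [div_self (sub_ne_zero.2 (by exact_mod_cast h.ne'))]
  simp

/-- `‖log l̇‖_t ≤ log (1 + ε / (t + 1))` implies `‖l - id‖_t ≤ ε`. -/
theorem exists_supNorm_le_of_logNorm_le (t : ℝ≥0) {ε : ℝ} (hε : 0 < ε) :
    ∃ δ > 0, δ ≤ ε ∧ ∀ l : TimeChange, logNorm l t ≤ ENNReal.ofReal δ →
      supNorm l t ≤ ENNReal.ofReal ε := by
  -- A slope from `0` within `η` of `1` moves `s ≤ t` by at most `η * s ≤ ε`. Adding `1` avoids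
  -- dividing by zero and gives `log (1 + η) ≤ η ≤ ε`.
  set η : ℝ := ε / (t + 1) with hη
  have ht : (0 : ℝ) ≤ t := t.2
  have hηpos : 0 < η := by positivity
  have hδ : 0 < Real.log (1 + η) := Real.log_pos (by linarith)
  refine ⟨Real.log (1 + η), hδ, ?_, fun l hl => ?_⟩
  · have h1 := Real.log_le_sub_one_of_pos (show 0 < 1 + η by linarith)
    have h2 : η ≤ ε := div_le_self hε.le (by linarith)
    linarith
  · rw [logNorm_le_iff hδ.le] at hl
    refine (supNorm_le_iff hε.le).2 fun s hs => ?_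
    rcases eq_or_ne s 0 with rfl | hs0
    · have : l 0 = 0 := map_bot l
      simp [this, hε.le]
    have hspos : 0 < s := pos_iff_ne_zero.2 hs0
    have h := hl 0 s hspos hs
    have hl0 : l 0 = 0 := map_bot l
    have hlpos : 0 < l s := hl0 ▸ l.strictMono hspos
    have hs' : (0 : ℝ) < s := by exact_mod_cast hspos
    have hl' : (0 : ℝ) < l s := by exact_mod_cast hlpos
    rw [hl0, NNReal.coe_zero, sub_zero, sub_zero, abs_le] at h
    have hq : 0 < (l s : ℝ) / s := div_pos hl' hs'
    have hup : (l s : ℝ) / s ≤ 1 + η := (Real.log_le_log_iff hq (by linarith)).1 h.2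
    have hlow : (1 + η)⁻¹ ≤ (l s : ℝ) / s := by
      refine (Real.log_le_log_iff (by positivity) hq).1 ?_
      rw [Real.log_inv]
      exact h.1
    have hlow' : 1 - η ≤ (l s : ℝ) / s := by
      refine le_trans ?_ hlow
      rw [inv_eq_one_div, le_div_iff₀ (by linarith)]
      nlinarith
    rw [div_le_iff₀ hs'] at hup
    rw [le_div_iff₀ hs'] at hlow'
    have hst : (s : ℝ) ≤ t + 1 := by
      have : (s : ℝ) ≤ t := by exact_mod_cast hs
      linarith
    have hηs : η * s ≤ ε := by
      calc η * s ≤ η * (t + 1) := by gcongr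
        _ = ε := by rw [hη]; field_simp
    rw [abs_le]
    constructor <;> nlinarith

/-- The slope bounds make `g` bi-Lipschitz with constant `exp ε`; surjectivity onto `ℝ≥0` is the
intermediate value theorem. -/
theorem exists_lipTimeChange_of_slope {g : ℝ≥0 → ℝ} {ε : ℝ} (hε : 0 < ε) (h0 : g 0 = 0)
    (hlow : ∀ s s' : ℝ≥0, s < s' → Real.exp (-ε) * ((s' : ℝ) - s) ≤ g s' - g s)
    (hup : ∀ s s' : ℝ≥0, s < s' → g s' - g s ≤ Real.exp ε * ((s' : ℝ) - s)) :
    ∃ m ∈ lipTimeChanges, (∀ s, (m s : ℝ) = g s) ∧ ∀ t, logNorm m t ≤ ENNReal.ofReal ε := by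
  have hpos : ∀ s s' : ℝ≥0, s < s' → (0 : ℝ) < (s' : ℝ) - s := fun s s' h =>
    sub_pos.2 (by exact_mod_cast h)
  have hmono : StrictMono g := fun s s' h => by
    have := hlow s s' h
    have := mul_pos (Real.exp_pos (-ε)) (hpos s s' h)
    linarith
  have hnn : ∀ s, 0 ≤ g s := fun s => h0 ▸ hmono.monotone (zero_le (a := s))
  let f : ℝ≥0 → ℝ≥0 := fun s => ⟨g s, hnn s⟩
  have hf : ∀ s, (f s : ℝ) = g s := fun s => rfl
  have hfmono : StrictMono f := fun s s' h => by
    rw [← NNReal.coe_lt_coe]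
    exact hmono h
  let L : ℝ≥0 := ⟨Real.exp ε, (Real.exp_pos ε).le⟩
  have hL : (L : ℝ) = Real.exp ε := rfl
  have hdist : ∀ s s' : ℝ≥0, dist (f s) (f s') ≤ L * dist s s' ∧
      dist s s' ≤ L * dist (f s) (f s') := by
    intro s s'
    wlog hss : s ≤ s' generalizing s s'
    · have := this s' s (le_of_not_ge hss)
      rwa [dist_comm (f s'), dist_comm s'] at this
    rcases hss.eq_or_lt with rfl | hlt
    · simp
    have h1 := hlow s s' hlt
    have h2 := hup s s' hlt
    have h3 := hpos s s' hlt
    rw [dist_comm (f s), dist_comm s, NNReal.dist_eq, NNReal.dist_eq, hf, hf, hL,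
      abs_of_pos h3, abs_of_pos (sub_pos.2 (hmono hlt))]
    refine ⟨h2, ?_⟩
    calc (s' : ℝ) - s = Real.exp ε * (Real.exp (-ε) * ((s' : ℝ) - s)) := by
          rw [← mul_assoc, ← Real.exp_add]; simp
      _ ≤ _ := by gcongr
  have hlip : LipschitzWith L f := LipschitzWith.of_dist_le_mul fun s s' => (hdist s s').1
  have hsurj : Function.Surjective f := fun y => by
    refine mem_range_of_exists_le_of_exists_ge hlip.continuous ⟨0, ?_⟩ ⟨L * y, ?_⟩
    · rw [← NNReal.coe_le_coe, hf, h0]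
      exact y.2
    · have := (hdist (L * y) 0).2
      rw [NNReal.dist_eq, NNReal.dist_eq, hf, hf, h0, NNReal.coe_zero, sub_zero, sub_zero,
        abs_of_nonneg (NNReal.coe_nonneg _), abs_of_nonneg (hnn _), NNReal.coe_mul, ← hf] at this
      exact le_of_mul_le_mul_left this (Real.exp_pos ε)
  let m : TimeChange := hfmono.orderIsoOfSurjective f hsurj
  have hm : ∀ s, m s = f s := fun s => rfl
  have hlip' : LipschitzWith L m.symm := LipschitzWith.of_dist_le_mul fun s s' => by
    have := (hdist (m.symm s) (m.symm s')).2
    rwa [← hm, ← hm, m.apply_symm_apply, m.apply_symm_apply] at this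
  refine ⟨m, ⟨hlip.locallyLipschitz, hlip'.locallyLipschitz⟩, fun s => rfl, fun t =>
    (logNorm_le_iff hε.le).2 fun s₁ s₂ h _ => ?_⟩
  have h1 := hlow s₁ s₂ h
  have h2 := hup s₁ s₂ h
  have h3 := hpos s₁ s₂ h
  have h4 := sub_pos.2 (hmono h)
  change |Real.log ((g s₂ - g s₁) / _)| ≤ ε
  rw [abs_le]
  constructor
  · rwa [Real.le_log_iff_exp_le (div_pos h4 h3), le_div_iff₀ h3]
  · rwa [Real.log_le_iff_le_exp (div_pos h4 h3), div_le_iff₀ h3]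

/-- The hat function of height `1` and half-width `r` at `p`. -/
noncomputable def hat (r p s : ℝ) : ℝ := max 0 (1 - |s - p| / r)

theorem hat_self (r p : ℝ) : hat r p p = 1 := by simp [hat]

theorem hat_eq_zero {r p s : ℝ} (hr : 0 < r) (h : r ≤ |s - p|) : hat r p s = 0 := by
  have : 1 ≤ |s - p| / r := (one_le_div hr).2 h
  exact max_eq_left (by linarith)

theorem abs_hat_sub_hat_le {r : ℝ} (hr : 0 < r) (p s s' : ℝ) :
    |hat r p s' - hat r p s| ≤ |s' - s| / r := by
  refine (abs_max_sub_max_le_max 0 _ 0 _).trans ?_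
  rw [sub_zero, abs_zero, max_eq_right (abs_nonneg _)]
  have : 1 - |s' - p| / r - (1 - |s - p| / r) = (|s - p| - |s' - p|) / r := by ring
  rw [this, abs_div, abs_of_pos hr]
  refine div_le_div_of_nonneg_right ((abs_abs_sub_abs_le (s - p) (s' - p)).trans ?_) hr.le
  rw [abs_sub_comm]
  exact le_of_eq (congrArg _ (by ring))

/-- A time change close to the identity agrees on a given finite set with a time change whose
slopes are close to `1`. -/
theorem exists_lipTimeChange_eqOn (F : Finset ℝ≥0) {ε : ℝ} (hε : 0 < ε) :
    ∃ δ > 0, ∀ l : TimeChange, (∀ p ∈ F, |(l p : ℝ) - p| ≤ δ) →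
      ∃ m ∈ lipTimeChanges, (∀ p ∈ F, m p = l p) ∧ ∀ t, logNorm m t ≤ ENNReal.ofReal ε := by
  classical
  -- Including `0` keeps the hats of the other points from moving the origin: the half-width `r` is
  -- at most the gaps of `G`, so each hat vanishes at the other points.
  set G := insert 0 F with hG
  obtain ⟨r, hr, hsep⟩ : ∃ r : ℝ, 0 < r ∧ ∀ e ∈ G.offDiag, r ≤ |((e.1 : ℝ≥0) : ℝ) - e.2| := by
    have : ∀ᶠ r : ℝ in 𝓝[>] 0, ∀ e ∈ G.offDiag, r ≤ |((e.1 : ℝ≥0) : ℝ) - e.2| := by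
      rw [Finset.eventually_all]
      intro e he
      have hne : 0 < |((e.1 : ℝ≥0) : ℝ) - e.2| := by
        rw [abs_pos, sub_ne_zero]
        exact_mod_cast (Finset.mem_offDiag.1 he).2.2
      exact mem_nhdsWithin_of_mem_nhds (Iic_mem_nhds hne)
    obtain ⟨r, h, hr⟩ := (this.and self_mem_nhdsWithin).exists
    exact ⟨r, hr, h⟩
  set η : ℝ := 1 - Real.exp (-ε) with hη
  have hηpos : 0 < η := by
    have : Real.exp (-ε) < 1 := Real.exp_lt_one_iff.2 (by linarith)
    linarith
  have hcard : (0 : ℝ) < G.card := by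
    exact_mod_cast Finset.card_pos.2 ⟨0, Finset.mem_insert_self _ _⟩
  -- Each hat is `1 / r`-Lipschitz, so the `G.card` corrections together change slopes by at most
  -- `η`.
  refine ⟨η * r / G.card, by positivity, fun l hl => ?_⟩
  have hl0 : l 0 = 0 := map_bot l
  have hlG : ∀ p ∈ G, |(l p : ℝ) - p| ≤ η * r / G.card := by
    intro p hp
    rcases Finset.mem_insert.1 hp with rfl | hp
    · rw [hl0]
      simp only [NNReal.coe_zero, sub_zero, abs_zero]
      positivity
    · exact hl p hp
  set g : ℝ≥0 → ℝ := fun s => s + ∑ p ∈ G, ((l p : ℝ) - p) * hat r p s with hg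
  have hgG : ∀ q ∈ G, g q = l q := by
    intro q hq
    have : ∑ p ∈ G, ((l p : ℝ) - p) * hat r p q = (l q : ℝ) - q := by
      rw [Finset.sum_eq_single_of_mem q hq, hat_self, mul_one]
      intro p hp hpq
      rw [hat_eq_zero hr (hsep (q, p) (Finset.mem_offDiag.2 ⟨hq, hp, hpq.symm⟩)), mul_zero]
    simp only [hg, this]
    ring
  have hincr : ∀ s s' : ℝ≥0, s < s' →
      |g s' - g s - ((s' : ℝ) - s)| ≤ η * ((s' : ℝ) - s) := by
    intro s s' hss
    have hss' : (s : ℝ) < s' := by exact_mod_cast hss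
    have : g s' - g s - ((s' : ℝ) - s) =
        ∑ p ∈ G, ((l p : ℝ) - p) * (hat r p s' - hat r p s) := by
      simp only [hg, mul_sub, Finset.sum_sub_distrib]
      ring
    rw [this]
    calc |∑ p ∈ G, ((l p : ℝ) - p) * (hat r p s' - hat r p s)|
        ≤ ∑ p ∈ G, |((l p : ℝ) - p) * (hat r p s' - hat r p s)| := Finset.abs_sum_le_sum_abs _ _
      _ ≤ ∑ p ∈ G, η * r / G.card * (((s' : ℝ) - s) / r) := by
          refine Finset.sum_le_sum fun p hp => ?_
          rw [abs_mul]
          have := abs_hat_sub_hat_le hr p s s'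
          rw [abs_of_pos (sub_pos.2 hss')] at this
          exact mul_le_mul (hlG p hp) this (abs_nonneg _) (by positivity)
      _ = η * ((s' : ℝ) - s) := by
          rw [Finset.sum_const, nsmul_eq_mul]
          field_simp
  -- This is `2 ≤ exp ε + exp (-ε)`; the lower slope `1 - η` equals `exp (-ε)` exactly.
  have hexp : 1 + η ≤ Real.exp ε := by
    have h1 : Real.exp (-ε) * Real.exp ε = 1 := by rw [← Real.exp_add]; simp
    have h2 := Real.exp_pos (-ε)
    have h3 := Real.exp_pos ε
    nlinarith [sq_nonneg (Real.exp ε - 1), Real.add_one_le_exp ε, Real.add_one_le_exp (-ε)]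
  obtain ⟨m, hm, hmg, hlog⟩ := exists_lipTimeChange_of_slope (g := g) hε
    (by rw [hgG 0 (Finset.mem_insert_self _ _), hl0, NNReal.coe_zero])
    (fun s s' h => by
      have := (abs_le.1 (hincr s s' h)).1
      have : Real.exp (-ε) = 1 - η := by ring
      rw [this]
      linarith)
    (fun s s' h => by
      have h1 := (abs_le.1 (hincr s s' h)).2
      have h2 : (0 : ℝ) < (s' : ℝ) - s := sub_pos.2 (by exact_mod_cast h)
      nlinarith)
  refine ⟨m, hm, fun p hp => ?_, hlog⟩
  rw [← NNReal.coe_inj, hmg, hgG p (Finset.mem_insert_of_mem hp)]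

end TimeChange

/-! ### Regularising time changes, and a diagonal choice -/

/-- A time change close to the identity can be replaced by one whose slopes are close to `1`, at
the cost of a small perturbation of the values of a given cadlag path. -/
theorem IsCadlagOn.exists_lipTimeChange {S : Type*} [TopologicalSpace S] {d : S → S → ℝ}
    (hd : IsMetricOf d) {x : ℝ≥0 → OnePoint S} {D : Set ℝ≥0} {T : ℝ≥0}
    (hx : IsCadlagOn x D T) (hD : D = Iic T ∨ D = Iio T) {ε : ℝ} (hε : 0 < ε) :
    ∃ δ > 0, ∀ l : TimeChange, supNorm l T ≤ ENNReal.ofReal δ →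
      ∃ m ∈ lipTimeChanges, m T = l T ∧ (∀ t, logNorm m t ≤ ENNReal.ofReal ε) ∧
        ∀ s ∈ D, l.symm (m s) ∈ D ∧ Near d ε (x s) (x (l.symm (m s))) := by
  classical
  obtain ⟨F, hF⟩ := hx.exists_finset hd hε
  -- `supNorm l T` gives no control beyond `T`, so later points of `F` are dropped; no time in `D`
  -- reaches them. Adding `T` forces `m T = l T`.
  obtain ⟨δ, hδ, h⟩ := exists_lipTimeChange_eqOn (insert T (F.filter (· ≤ T))) hε
  refine ⟨δ, hδ, fun l hl => ?_⟩
  rw [supNorm_le_iff hδ.le] at hl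
  obtain ⟨m, hm, hml, hlog⟩ := h l fun p hp => hl p <| by
    rcases Finset.mem_insert.1 hp with rfl | hp
    · exact le_rfl
    · exact (Finset.mem_filter.1 hp).2
  have hT : m T = l T := hml T (Finset.mem_insert_self _ _)
  -- Where `m` and `l` agree, the increasing map `l⁻¹ ∘ m` has a fixed point, so it preserves the
  -- sides of that point.
  have hle : ∀ p s : ℝ≥0, m p = l p → (p ≤ s ↔ p ≤ l.symm (m s)) := fun p s hp => by
    rw [l.le_symm_apply, ← hp, m.le_iff_le]
  have hle' : ∀ s : ℝ≥0, (s ≤ T ↔ l.symm (m s) ≤ T) := fun s => by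
    rw [l.symm_apply_le, ← hT, m.le_iff_le]
  refine ⟨m, hm, hT, hlog, fun s hs => ?_⟩
  have hs' : l.symm (m s) ∈ D := by
    rcases hD with rfl | rfl
    · exact (hle' s).1 hs
    · exact lt_of_not_ge fun hc => not_le.2 hs ((hle T s hT).2 hc)
  refine ⟨hs', hF s hs _ hs' fun p hp => ?_⟩
  by_cases hpT : p ≤ T
  · exact hle p s (hml p (Finset.mem_insert_of_mem (Finset.mem_filter.2 ⟨hp, hpT⟩)))
  · exact iff_of_false (fun hc => hpT (hc.trans (hx.le s hs)))
      (fun hc => hpT (hc.trans (hx.le _ hs')))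

/-- For each `k`, solve `R n k` for the largest solvable `n ≤ k`; by monotonicity this solves all
smaller levels. The default `l₀` serves the `k` with no solvable level. -/
theorem exists_diagonal {L : Type*} {A : Set L} (hA : A.Nonempty) {R : ℕ → ℕ → L → Prop}
    (hR : ∀ n n' k l, n ≤ n' → R n' k l → R n k l)
    (h : ∀ n, ∀ᶠ k in atTop, ∃ l ∈ A, R n k l) :
    ∃ l : ℕ → L, (∀ k, l k ∈ A) ∧ ∀ n, ∀ᶠ k in atTop, R n k (l k) := by
  classical
  obtain ⟨l₀, hl₀⟩ := hA
  have hex : ∀ k, ∃ l ∈ A, (∃ l' ∈ A, R (Nat.findGreatest (fun n => ∃ l' ∈ A, R n k l') k) k l') →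
      R (Nat.findGreatest (fun n => ∃ l' ∈ A, R n k l') k) k l := fun k => by
    by_cases hk : ∃ l' ∈ A, R (Nat.findGreatest (fun n => ∃ l' ∈ A, R n k l') k) k l'
    · obtain ⟨l, hl, hRl⟩ := hk
      exact ⟨l, hl, fun _ => hRl⟩
    · exact ⟨l₀, hl₀, fun hc => absurd hc hk⟩
  choose l hlA hl using hex
  refine ⟨l, hlA, fun n => ?_⟩
  filter_upwards [h n, eventually_ge_atTop n] with k hk hnk
  have hle : n ≤ Nat.findGreatest (fun n => ∃ l' ∈ A, R n k l') k := Nat.le_findGreatest hnk hk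
  exact hR _ _ _ _ hle (hl k (Nat.findGreatest_spec (P := fun n => ∃ l' ∈ A, R n k l') hnk hk))

/-! ### The criteria as convergence along filters -/

section Criterion

variable {S : Type*} [TopologicalSpace S] {d d' : S → S → ℝ} {A : Set TimeChange}
  {N : TimeChange → ℝ≥0 → ℝ≥0∞}

theorem tendsto_infty_iff [T2Space S] {ι : Type*} {f : Filter ι} {u : ι → OnePoint S} :
    Tendsto u f (𝓝 OnePoint.infty) ↔
      ∀ K : Set S, IsCompact K → ∀ᶠ k in f, u k ∉ ((↑) : S → OnePoint S) '' K := by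
  rw [OnePoint.hasBasis_nhds_infty.tendsto_right_iff]
  simp only [← OnePoint.compl_image_coe, mem_compl_iff]
  exact ⟨fun h K hK => h K ⟨hK.isClosed, hK⟩, fun h K hK => h K hK.2⟩

theorem ExpPath.ne_infty (x : ExpPath S) {t : ℝ≥0} (ht : (t : ℝ≥0∞) < x.xi) :
    x.val t ≠ OnePoint.infty := fun h => not_le.2 ht ((x.val_eq_infty_iff t).1 h)

theorem Near.lt_xi {x : ExpPath S} {ε : ℝ} {p : OnePoint S} {t : ℝ≥0}
    (h : Near d ε p (x.val t)) : (t : ℝ≥0∞) < x.xi := by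
  obtain ⟨a, b, -, hb, -⟩ := h
  by_contra hc
  exact OnePoint.coe_ne_infty b (hb ▸ (x.val_eq_infty_iff t).2 (not_lt.1 hc))

theorem ExpPath.cadlag_left (x : ExpPath S) (D : Set ℝ≥0) {u : ℝ≥0} (hu : (u : ℝ≥0∞) < x.xi) :
    𝓝[D ∩ Iio u] u = ⊥ ∨ ∃ a : S, Tendsto x.val (𝓝[D ∩ Iio u] u) (𝓝 (a : OnePoint S)) := by
  rcases eq_or_ne u 0 with rfl | h0
  · left
    have : Iio (0 : ℝ≥0) = ∅ := Iio_bot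
    rw [this, inter_empty, nhdsWithin_empty]
  · obtain ⟨a, ha⟩ := x.left_limit u (pos_iff_ne_zero.2 h0) hu
    exact Or.inr ⟨a, ha.mono_left (nhdsWithin_mono _ inter_subset_right)⟩

theorem ExpPath.tendsto_Ici (x : ExpPath S) {u : ℝ≥0} (hu : (u : ℝ≥0∞) < x.xi) :
    Tendsto x.val (𝓝[≥] u) (𝓝 (x.val u)) :=
  continuousWithinAt_Ioi_iff_Ici.1 (x.right_continuous u hu)

theorem ExpPath.cadlag_right (x : ExpPath S) (D : Set ℝ≥0) {u : ℝ≥0} (hu : (u : ℝ≥0∞) < x.xi) :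
    𝓝[D ∩ Ici u] u = ⊥ ∨ ∃ a : S, Tendsto x.val (𝓝[D ∩ Ici u] u) (𝓝 (a : OnePoint S)) := by
  obtain ⟨a, ha⟩ := OnePoint.ne_infty_iff_exists.1 (x.ne_infty hu)
  refine Or.inr ⟨a, ?_⟩
  rw [ha]
  exact (x.tendsto_Ici hu).mono_left (nhdsWithin_mono _ inter_subset_right)

theorem ExpPath.isCadlagOn_Iic (x : ExpPath S) {t : ℝ≥0} (ht : (t : ℝ≥0∞) < x.xi) :
    IsCadlagOn x.val (Iic t) t where
  le _ hs := hs
  left _ hu := x.cadlag_left _ ((ENNReal.coe_le_coe.2 hu).trans_lt ht)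
  right _ hu := x.cadlag_right _ ((ENNReal.coe_le_coe.2 hu).trans_lt ht)

theorem LocPath.isCadlagOn_Iio (x : LocPath S) {T : ℝ≥0} (hT : x.xi = T) (hx : x.RelCompact) :
    IsCadlagOn x.val (Iio T) T where
  le _ hs := le_of_lt hs
  left u hu := by
    rcases hu.lt_or_eq with h | rfl
    · exact x.cadlag_left _ (hT ▸ ENNReal.coe_lt_coe.2 h)
    rcases eq_or_ne u 0 with rfl | h0
    · left
      have : Iio (0 : ℝ≥0) = ∅ := Iio_bot
      rw [this, inter_empty, nhdsWithin_empty]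
    · obtain ⟨a, ha⟩ := x.left_limit_xi u (pos_iff_ne_zero.2 h0) hT hx
      exact Or.inr ⟨a, ha.mono_left (nhdsWithin_mono _ inter_subset_right)⟩
  right u hu := by
    rcases hu.lt_or_eq with h | rfl
    · exact x.cadlag_right _ (hT ▸ ENNReal.coe_lt_coe.2 h)
    · left
      have : Iio u ∩ Ici u = ∅ := by
        ext s
        simp
      rw [this, nhdsWithin_empty]

/-- The criterion in terms of `ε` and of compact sets. -/
theorem criterion_iff [T2Space S] {x : LocPath S} {xk : ℕ → LocPath S} :
    Criterion d A N x xk ↔ ∃ l : ℕ → TimeChange, (∀ k, l k ∈ A) ∧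
      ((∃ T : ℝ≥0, x.xi = T ∧ x.RelCompact ∧
        (∀ᶠ k in atTop, ((l k T : ℝ≥0) : ℝ≥0∞) ≤ (xk k).xi) ∧
        (∀ ε : ℝ, 0 < ε → ∀ᶠ k in atTop, ∀ s < T, Near d ε (x.val s) ((xk k).val (l k s))) ∧
        (∀ K : Set S, IsCompact K →
          ∀ᶠ k in atTop, (xk k).val (l k T) ∉ ((↑) : S → OnePoint S) '' K) ∧
        ∀ ε : ℝ, 0 < ε → ∀ᶠ k in atTop, N (l k) T ≤ ENNReal.ofReal ε) ∨
      ((x.xi = ⊤ ∨ ¬ x.RelCompact) ∧ ∀ t : ℝ≥0, (t : ℝ≥0∞) < x.xi →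
        (∀ ε : ℝ, 0 < ε → ∀ᶠ k in atTop, ∀ s ≤ t, Near d ε (x.val s) ((xk k).val (l k s))) ∧
        ∀ ε : ℝ, 0 < ε → ∀ᶠ k in atTop, N (l k) t ≤ ENNReal.ofReal ε)) := by
  have hsup : ∀ (l : ℕ → TimeChange) (D : Set ℝ≥0),
      Tendsto (fun k => ⨆ (s : ℝ≥0) (_ : s ∈ D), distS d (x.val s) ((xk k).val (l k s)))
        atTop (𝓝 0) ↔ ∀ ε : ℝ, 0 < ε → ∀ᶠ k in atTop, ∀ s ∈ D,
          Near d ε (x.val s) ((xk k).val (l k s)) := by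
    intro l D
    rw [tendsto_ennreal_zero_iff]
    refine forall₂_congr fun ε hε => ?_
    simp only [iSup_le_iff, distS_le_iff (le_of_lt hε)]
  unfold Criterion
  refine exists_congr fun l => and_congr_right fun _ => or_congr ?_ ?_
  · refine exists_congr fun T => and_congr_right fun hT => and_congr_right fun _ =>
      and_congr_right fun _ => and_congr ?_ (and_congr tendsto_infty_iff tendsto_ennreal_zero_iff)
    have := hsup l (Iio T)
    simpa only [hT, ENNReal.coe_lt_coe, mem_Iio] using this
  · refine and_congr_right fun _ => forall₂_congr fun t _ => ?_
    rw [tendsto_ennreal_zero_iff (f := fun k => N (l k) t)]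
    constructor
    · rintro ⟨-, h2, h3⟩
      exact ⟨(hsup l (Iic t)).1 h2, h3⟩
    · rintro ⟨h2, h3⟩
      -- Closeness at `s = t` already forces `l k t < ξ(xk k)`, since `Near` only relates points of
      -- `S`.
      refine ⟨(h2 1 one_pos).mono fun k hk => (hk t le_rfl).lt_xi, (hsup l (Iic t)).2 h2, h3⟩

/-- The paths close to `x` on `[0, t]` up to a time change. -/
def approxOn (d : S → S → ℝ) (A : Set TimeChange) (N : TimeChange → ℝ≥0 → ℝ≥0∞) (x : LocPath S)
    (t : ℝ≥0) (ε : ℝ) : Set (LocPath S) :=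
  {y | ∃ l ∈ A, (∀ s ≤ t, Near d ε (x.val s) (y.val (l s))) ∧ N l t ≤ ENNReal.ofReal ε}

/-- The paths close to `x` on `[0, T)` up to a time change, and outside `K` at time `T`. -/
def approxUpTo (d : S → S → ℝ) (A : Set TimeChange) (N : TimeChange → ℝ≥0 → ℝ≥0∞) (x : LocPath S)
    (T : ℝ≥0) (ε : ℝ) (K : Set S) : Set (LocPath S) :=
  {y | ∃ l ∈ A, ((l T : ℝ≥0) : ℝ≥0∞) ≤ y.xi ∧ (∀ s < T, Near d ε (x.val s) (y.val (l s))) ∧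
    y.val (l T) ∉ ((↑) : S → OnePoint S) '' K ∧ N l T ≤ ENNReal.ofReal ε}

/-- The filter of paths close to `x`; see `criterion_iff_tendsto`. -/
def criterionFilter (d : S → S → ℝ) (A : Set TimeChange) (N : TimeChange → ℝ≥0 → ℝ≥0∞)
    (x : LocPath S) : Filter (LocPath S) :=
  generate {G | (∃ T : ℝ≥0, x.xi = T ∧ x.RelCompact ∧ ∃ ε : ℝ, 0 < ε ∧ ∃ K, IsCompact K ∧
      G = approxUpTo d A N x T ε K) ∨
    ((x.xi = ⊤ ∨ ¬ x.RelCompact) ∧ ∃ t : ℝ≥0, (t : ℝ≥0∞) < x.xi ∧ ∃ ε : ℝ, 0 < ε ∧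
      G = approxOn d A N x t ε)}

theorem le_criterionFilter_iff {x : LocPath S} {f : Filter (LocPath S)} :
    f ≤ criterionFilter d A N x ↔
      (∀ T : ℝ≥0, x.xi = T → x.RelCompact → ∀ ε : ℝ, 0 < ε → ∀ K, IsCompact K →
        approxUpTo d A N x T ε K ∈ f) ∧
      (x.xi = ⊤ ∨ ¬ x.RelCompact → ∀ t : ℝ≥0, (t : ℝ≥0∞) < x.xi → ∀ ε : ℝ, 0 < ε →
        approxOn d A N x t ε ∈ f) := by
  rw [criterionFilter, le_generate_iff]
  constructor
  · intro h
    exact ⟨fun T hT hx ε hε K hK => h (Or.inl ⟨T, hT, hx, ε, hε, K, hK, rfl⟩),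
      fun hx t ht ε hε => h (Or.inr ⟨hx, t, ht, ε, hε, rfl⟩)⟩
  · rintro ⟨h, h'⟩ G (⟨T, hT, hx, ε, hε, K, hK, rfl⟩ | ⟨hx, t, ht, ε, hε, rfl⟩)
    · exact h T hT hx ε hε K hK
    · exact h' hx t ht ε hε

theorem pure_le_criterionFilter (hd : IsMetricOf d) (hA : OrderIso.refl ℝ≥0 ∈ A)
    (hN : ∀ t, N (OrderIso.refl ℝ≥0) t = 0) (x : LocPath S) : pure x ≤ criterionFilter d A N x := by
  refine le_criterionFilter_iff.2 ⟨fun T hT _ ε hε K _ => ?_, fun _ t ht ε hε => ?_⟩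
  · refine ⟨_, hA, hT.ge, fun s hs => near_self hd hε.le (x.ne_infty ?_), ?_, ?_⟩
    · rw [hT]
      exact_mod_cast hs
    · rw [OrderIso.refl_apply, (x.val_eq_infty_iff T).2 hT.le]
      exact OnePoint.infty_notMem_image_coe
    · rw [hN]
      exact zero_le
  · refine ⟨_, hA, fun s hs => near_self hd hε.le (x.ne_infty ?_), ?_⟩
    · exact (ENNReal.coe_le_coe.2 hs).trans_lt ht
    · rw [hN]
      exact zero_le

/-- The filter lets the time change depend on `ε`, `t` and `K`, while the criterion wants one
sequence for all. Countably many of these parameters are cofinal, so a diagonal choice suffices. -/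
theorem criterion_iff_tendsto [T2Space S] [LocallyCompactSpace S] [SecondCountableTopology S]
    (hA : A.Nonempty) (hN : ∀ l, Monotone (N l)) {x : LocPath S} {xk : ℕ → LocPath S} :
    Criterion d A N x xk ↔ Tendsto xk atTop (criterionFilter d A N x) := by
  rw [criterion_iff, Tendsto, le_criterionFilter_iff]
  constructor
  · rintro ⟨l, hl, ⟨T, hT, hx, h1, h2, h3, h4⟩ | ⟨hx, h⟩⟩
    · refine ⟨fun T' hT' _ ε hε K hK => ?_, fun hx' => ?_⟩
      · obtain rfl : T = T' := by exact_mod_cast hT.symm.trans hT'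
        refine mem_map.2 ?_
        filter_upwards [h1, h2 ε hε, h3 K hK, h4 ε hε] with k hk1 hk2 hk3 hk4
        exact ⟨l k, hl k, hk1, hk2, hk3, hk4⟩
      · rcases hx' with hx' | hx'
        · exact absurd (hT.symm.trans hx') ENNReal.coe_ne_top
        · exact absurd hx hx'
    · refine ⟨fun T hT hx' => ?_, fun _ t ht ε hε => ?_⟩
      · rcases hx with hx | hx
        · exact absurd (hT.symm.trans hx) ENNReal.coe_ne_top
        · exact absurd hx' hx
      · refine mem_map.2 ?_
        filter_upwards [(h t ht).1 ε hε, (h t ht).2 ε hε] with k hk1 hk2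
        exact ⟨l k, hl k, hk1, hk2⟩
  · rintro ⟨h1, h2⟩
    have hε : ∀ n : ℕ, (0 : ℝ) < 1 / (n + 1) := fun n => Nat.one_div_pos_of_nat
    have hε' : ∀ n n' : ℕ, n ≤ n' → (1 : ℝ) / (n' + 1) ≤ 1 / (n + 1) := fun n n' hn =>
      Nat.one_div_le_one_div hn
    have hlim := tendsto_one_div_add_atTop_nhds_zero_nat (𝕜 := ℝ)
    by_cases hx : x.xi = ⊤ ∨ ¬ x.RelCompact
    -- If `ξ(x) = 0` there is no `t` to test; otherwise times `v n` increasing to `ξ(x)` suffice.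
    · rcases eq_or_ne x.xi 0 with h0 | h0
      · obtain ⟨l₀, hl₀⟩ := hA
        exact ⟨fun _ => l₀, fun _ => hl₀, Or.inr ⟨hx, fun t ht => by simp [h0] at ht⟩⟩
      obtain ⟨v, hvmono, hvlt, hv⟩ := exists_seq_strictMono_tendsto' (pos_iff_ne_zero.2 h0)
      have hvtop : ∀ n, v n ≠ ⊤ := fun n => ((hvlt n).2.trans_le le_top).ne
      refine (exists_diagonal hA
        (R := fun n k l => (∀ s ≤ (v n).toNNReal,
          Near d (1 / (n + 1)) (x.val s) ((xk k).val (l s))) ∧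
            N l (v n).toNNReal ≤ ENNReal.ofReal (1 / (n + 1))) ?_ ?_).elim fun l ⟨hlA, hl⟩ => ?_
      rotate_left 2
      · refine ⟨l, hlA, Or.inr ⟨hx, fun t ht => ?_⟩⟩
        have htn : ∀ᶠ n in atTop, t ≤ (v n).toNNReal :=
          (hv.eventually (lt_mem_nhds ht)).mono fun n hn => by
            rw [← ENNReal.coe_le_coe, ENNReal.coe_toNNReal (hvtop n)]
            exact le_of_lt hn
        refine ⟨fun ε hε => ?_, fun ε hε => ?_⟩
        all_goals
          obtain ⟨n, hn, hnε⟩ := (htn.and (hlim.eventually_le_const hε)).exists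
          filter_upwards [hl n] with k hk
        · exact fun s hs => (hk.1 s (hs.trans hn)).mono hnε
        · exact (hN _ hn).trans (hk.2.trans (ENNReal.ofReal_le_ofReal hnε))
      · rintro n n' k l hn ⟨h, h'⟩
        have hvn : (v n).toNNReal ≤ (v n').toNNReal :=
          ENNReal.toNNReal_mono (hvtop n') (hvmono.monotone hn)
        exact ⟨fun s hs => (h s (hs.trans hvn)).mono (hε' n n' hn),
          (hN _ hvn).trans (h'.trans (ENNReal.ofReal_le_ofReal (hε' n n' hn)))⟩
      · intro n
        refine h2 hx _ ?_ _ (hε n)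
        rw [ENNReal.coe_toNNReal (hvtop n)]
        exact (hvlt n).2
    · push Not at hx
      obtain ⟨T, hT⟩ : ∃ T : ℝ≥0, (T : ℝ≥0∞) = x.xi := ⟨_, ENNReal.coe_toNNReal hx.1⟩
      let E := CompactExhaustion.choice S
      refine (exists_diagonal hA
        (R := fun n k l => ((l T : ℝ≥0) : ℝ≥0∞) ≤ (xk k).xi ∧
          (∀ s < T, Near d (1 / (n + 1)) (x.val s) ((xk k).val (l s))) ∧
          (xk k).val (l T) ∉ ((↑) : S → OnePoint S) '' E n ∧
            N l T ≤ ENNReal.ofReal (1 / (n + 1))) ?_ ?_).elim fun l ⟨hlA, hl⟩ => ?_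
      rotate_left 2
      · refine ⟨l, hlA, Or.inl ⟨T, hT.symm, hx.2, (hl 0).mono fun k hk => hk.1, fun ε hε => ?_,
          fun K hK => ?_, fun ε hε => ?_⟩⟩
        · obtain ⟨n, hnε⟩ := (hlim.eventually_le_const hε).exists
          exact (hl n).mono fun k hk s hs => (hk.2.1 s hs).mono hnε
        · obtain ⟨n, hn⟩ := E.exists_superset_of_isCompact hK
          exact (hl n).mono fun k hk hc => hk.2.2.1 (image_mono hn hc)
        · obtain ⟨n, hnε⟩ := (hlim.eventually_le_const hε).exists
          exact (hl n).mono fun k hk => hk.2.2.2.trans (ENNReal.ofReal_le_ofReal hnε)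
      · rintro n n' k l hn ⟨h, h', h'', h'''⟩
        exact ⟨h, fun s hs => (h' s hs).mono (hε' n n' hn),
          fun hc => h'' (image_mono (E.subset hn) hc),
          h'''.trans (ENNReal.ofReal_le_ofReal (hε' n n' hn))⟩
      · exact fun n => h1 T hT.symm hx.2 _ (hε n) _ (E.isCompact n)

/-- Only values of `x` on a bounded interval are compared at a time, and these lie in a compact set.
-/
theorem Criterion.of_metric [T2Space S] [LocallyCompactSpace S] (hd : IsMetricOf d)
    (hd' : IsMetricOf d') {x : LocPath S} {xk : ℕ → LocPath S} (h : Criterion d A N x xk) :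
    Criterion d' A N x xk := by
  rw [criterion_iff] at h ⊢
  obtain ⟨l, hl, h⟩ := h
  refine ⟨l, hl, h.imp ?_ ?_⟩
  · rintro ⟨T, hT, hx, h1, h2, h3, h4⟩
    refine ⟨T, hT, hx, h1, fun ε hε => ?_, h3, h4⟩
    obtain ⟨K, hK, hxK⟩ := (x.isCadlagOn_Iio hT hx).exists_isCompact
    obtain ⟨δ, hδ, hcomp⟩ := exists_metric_comparison hd hd' hK hε
    exact (h2 δ hδ).mono fun k hk s hs => (hk s hs).metric_mono hcomp (hxK s hs)
  · rintro ⟨hx, h⟩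
    refine ⟨hx, fun t ht => ⟨fun ε hε => ?_, (h t ht).2⟩⟩
    obtain ⟨K, hK, hxK⟩ := (x.isCadlagOn_Iic ht).exists_isCompact
    obtain ⟨δ, hδ, hcomp⟩ := exists_metric_comparison hd hd' hK hε
    exact ((h t ht).1 δ hδ).mono fun k hk s hs => (hk s hs).metric_mono hcomp (hxK s hs)

theorem criterionFilter_log_le_sup (x : LocPath S) :
    criterionFilter d lipTimeChanges logNorm x ≤ criterionFilter d univ supNorm x := by
  refine le_criterionFilter_iff.2 ⟨fun T hT hx ε hε K hK => ?_, fun hx t ht ε hε => ?_⟩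
  · obtain ⟨δ, hδ, hδε, h⟩ := exists_supNorm_le_of_logNorm_le T hε
    refine mem_of_superset ((le_criterionFilter_iff.1 le_rfl).1 T hT hx δ hδ K hK) ?_
    rintro y ⟨l, -, h1, h2, h3, h4⟩
    exact ⟨l, mem_univ _, h1, fun s hs => (h2 s hs).mono hδε, h3, h l h4⟩
  · obtain ⟨δ, hδ, hδε, h⟩ := exists_supNorm_le_of_logNorm_le t hε
    refine mem_of_superset ((le_criterionFilter_iff.1 le_rfl).2 hx t ht δ hδ) ?_
    rintro y ⟨l, -, h1, h2⟩
    exact ⟨l, mem_univ _, fun s hs => (h1 s hs).mono hδε, h l h2⟩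

theorem criterionFilter_sup_le_log (hd : IsMetricOf d) (x : LocPath S) :
    criterionFilter d univ supNorm x ≤ criterionFilter d lipTimeChanges logNorm x := by
  have key : ∀ (D : Set ℝ≥0) (T : ℝ≥0), IsCadlagOn x.val D T → (D = Iic T ∨ D = Iio T) →
      ∀ ε : ℝ, 0 < ε → ∃ δ > 0, ∀ (y : LocPath S) (l : TimeChange),
        (∀ s ∈ D, Near d δ (x.val s) (y.val (l s))) → supNorm l T ≤ ENNReal.ofReal δ →
        ∃ m ∈ lipTimeChanges, m T = l T ∧ (∀ s ∈ D, Near d ε (x.val s) (y.val (m s))) ∧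
          logNorm m T ≤ ENNReal.ofReal ε := by
    intro D T hx hD ε hε
    obtain ⟨δ, hδ, h⟩ := hx.exists_lipTimeChange hd hD (half_pos hε)
    -- One half of `ε` pays for replacing `x s` by `x (l⁻¹ (m s))`, the other for the distance from
    -- there to `y (m s)`.
    refine ⟨min δ (ε / 2), lt_min hδ (half_pos hε), fun y l hl hT => ?_⟩
    obtain ⟨m, hm, hmT, hlog, hnear⟩ :=
      h l (hT.trans (ENNReal.ofReal_le_ofReal (min_le_left _ _)))
    refine ⟨m, hm, hmT, fun s hs => ?_,
      (hlog T).trans (ENNReal.ofReal_le_ofReal (by linarith))⟩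
    have h2 := (hl _ (hnear s hs).1).mono (min_le_right _ _)
    rw [l.apply_symm_apply] at h2
    exact ((hnear s hs).2.trans hd h2).mono (by linarith)
  refine le_criterionFilter_iff.2 ⟨fun T hT hx ε hε K hK => ?_, fun hx t ht ε hε => ?_⟩
  · obtain ⟨δ, hδ, h⟩ := key _ T (x.isCadlagOn_Iio hT hx) (Or.inr rfl) ε hε
    refine mem_of_superset ((le_criterionFilter_iff.1 le_rfl).1 T hT hx δ hδ K hK) ?_
    rintro y ⟨l, -, h1, h2, h3, h4⟩
    obtain ⟨m, hm, hmT, hnear, hlog⟩ := h y l h2 h4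
    exact ⟨m, hm, hmT.symm ▸ h1, hnear, hmT.symm ▸ h3, hlog⟩
  · obtain ⟨δ, hδ, h⟩ := key _ t (x.isCadlagOn_Iic ht) (Or.inl rfl) ε hε
    refine mem_of_superset ((le_criterionFilter_iff.1 le_rfl).2 hx t ht δ hδ) ?_
    rintro y ⟨l, -, h1, h2⟩
    obtain ⟨m, hm, -, hnear, hlog⟩ := h y l h1 h2
    exact ⟨m, hm, hnear, hlog⟩

end Criterion

/-! ### Uniqueness of limits -/

theorem tendsto_symm_apply {m : ℕ → TimeChange} {c : ℕ → ℝ≥0} {s v : ℝ≥0} (hv : s < v)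
    (hm : ∀ r ≤ v, Tendsto (fun k => m k r) atTop (𝓝 r)) (hc : Tendsto c atTop (𝓝 s)) :
    Tendsto (fun k => (m k).symm (c k)) atTop (𝓝 s) := by
  refine tendsto_order.2 ⟨fun a ha => ?_, fun b hb => ?_⟩
  · filter_upwards [(hm a (ha.trans hv).le).eventually_lt hc ha] with k hk
    exact (m k).lt_symm_apply.2 hk
  · filter_upwards [hc.eventually_lt (hm (min b v) (min_le_right _ _)) (lt_min hb hv)] with k hk
    exact ((m k).symm_apply_lt.2 hk).trans_le (min_le_left _ _)

variable {S : Type*} [TopologicalSpace S] {d : S → S → ℝ} {x y : LocPath S} {u : ℕ → LocPath S}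

/-- The time changes `l k` witness the convergence of the paths `u k` to `x` on each `[0, t]` with
`t < ξ(x)`. -/
structure Tracks (d : S → S → ℝ) (x : LocPath S) (u : ℕ → LocPath S) (l : ℕ → TimeChange) :
    Prop where
  near : ∀ t : ℝ≥0, (t : ℝ≥0∞) < x.xi → ∀ ε : ℝ, 0 < ε →
    ∀ᶠ k in atTop, ∀ s ≤ t, Near d ε (x.val s) ((u k).val (l k s))
  tendsto : ∀ t : ℝ≥0, (t : ℝ≥0∞) < x.xi → Tendsto (fun k => l k t) atTop (𝓝 t)

theorem tendsto_of_supNorm {l : ℕ → TimeChange} {t : ℝ≥0}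
    (h : ∀ ε : ℝ, 0 < ε → ∀ᶠ k in atTop, supNorm (l k) t ≤ ENNReal.ofReal ε) :
    Tendsto (fun k => l k t) atTop (𝓝 t) := by
  refine Metric.tendsto_nhds.2 fun ε hε => ?_
  filter_upwards [h (ε / 2) (half_pos hε)] with k hk
  have := (supNorm_le_iff (half_pos hε).le).1 hk t le_rfl
  rw [NNReal.dist_eq]
  linarith

theorem SupCriterion.exists_tracks [T2Space S] (h : SupCriterion d x u) :
    ∃ l : ℕ → TimeChange, Tracks d x u l ∧ ∀ T : ℝ≥0, x.xi = T → x.RelCompact →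
      Tendsto (fun k => l k T) atTop (𝓝 T) ∧ ∀ K : Set S, IsCompact K →
        ∀ᶠ k in atTop, (u k).val (l k T) ∉ ((↑) : S → OnePoint S) '' K := by
  obtain ⟨l, -, h⟩ := criterion_iff.1 h
  refine ⟨l, ?_⟩
  rcases h with ⟨T, hT, hx, -, h2, h3, h4⟩ | ⟨hx, h⟩
  · refine ⟨⟨fun t ht ε hε => ?_, fun t ht => ?_⟩, fun T' hT' _ => ?_⟩
    · rw [hT, ENNReal.coe_lt_coe] at ht
      exact (h2 ε hε).mono fun k hk s hs => hk s (hs.trans_lt ht)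
    · rw [hT, ENNReal.coe_lt_coe] at ht
      exact tendsto_of_supNorm fun ε hε => (h4 ε hε).mono fun k hk =>
        (supNorm_mono _ ht.le).trans hk
    · obtain rfl : T = T' := by exact_mod_cast hT.symm.trans hT'
      exact ⟨tendsto_of_supNorm h4, h3⟩
  · refine ⟨⟨fun t ht => (h t ht).1, fun t ht => tendsto_of_supNorm (h t ht).2⟩,
      fun T hT hx' => ?_⟩
    rcases hx with hx | hx
    · exact absurd (hT.symm.trans hx) ENNReal.coe_ne_top
    · exact absurd hx' hx

/-- Read the tracking of `y` at the time `m⁻¹ (c k)`, which stays below some `v < ξ(y)`. -/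
theorem Tracks.near_of_tendsto {m : ℕ → TimeChange} (hm : Tracks d y u m) {s : ℝ≥0}
    (hs : (s : ℝ≥0∞) < y.xi) {c : ℕ → ℝ≥0} (hc : Tendsto c atTop (𝓝 s)) :
    Tendsto (fun k => (m k).symm (c k)) atTop (𝓝 s) ∧ ∀ ε : ℝ, 0 < ε →
      ∀ᶠ k in atTop, Near d ε (y.val ((m k).symm (c k))) ((u k).val (c k)) := by
  obtain ⟨v, hsv, hvy⟩ := ENNReal.lt_iff_exists_nnreal_btwn.1 hs
  rw [ENNReal.coe_lt_coe] at hsv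
  have hlim := tendsto_symm_apply hsv
    (fun r hr => hm.tendsto r ((ENNReal.coe_le_coe.2 hr).trans_lt hvy)) hc
  refine ⟨hlim, fun ε hε => ?_⟩
  filter_upwards [hm.near v hvy ε hε, hlim.eventually (gt_mem_nhds hsv)] with k hk hkv
  have := hk _ hkv.le
  rwa [(m k).apply_symm_apply] at this

theorem ExpPath.exists_forall_near (hd : IsMetricOf d) (x : ExpPath S) {s : ℝ≥0}
    (hs : (s : ℝ≥0∞) < x.xi) {ε : ℝ} (hε : 0 < ε) :
    ∃ v > s, ∀ r, s < r → r < v → Near d ε (x.val s) (x.val r) := by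
  obtain ⟨a, ha⟩ := OnePoint.ne_infty_iff_exists.1 (x.ne_infty hs)
  have h := x.right_continuous s hs
  rw [← ha] at h
  obtain ⟨v, hv, h'⟩ := mem_nhdsGT_iff_exists_Ioo_subset.1 (h (eventually_near hd a hε))
  exact ⟨v, hv, fun r hr hrv => ha ▸ h' ⟨hr, hrv⟩⟩

/-- At `s` itself, `m⁻¹ (l s)` could approach `s` from the left and see a jump of `y`. The
comparison is made at `r` slightly to the right of `s`, and right-continuity brings it back to `s`.
-/
theorem Tracks.val_eq (hd : IsMetricOf d) {l m : ℕ → TimeChange} (hl : Tracks d x u l)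
    (hm : Tracks d y u m) {s : ℝ≥0} (hsx : (s : ℝ≥0∞) < x.xi) (hsy : (s : ℝ≥0∞) < y.xi) :
    x.val s = y.val s := by
  obtain ⟨a, ha⟩ := OnePoint.ne_infty_iff_exists.1 (x.ne_infty hsx)
  obtain ⟨b, hb⟩ := OnePoint.ne_infty_iff_exists.1 (y.ne_infty hsy)
  rw [← ha, ← hb]
  refine congrArg _ (hd.eq_of_forall_le fun ε hε => ?_)
  have hε4 : 0 < ε / 4 := by positivity
  obtain ⟨v, hv, hxv⟩ := x.exists_forall_near hd hsx hε4
  obtain ⟨w, hw, hyw⟩ := y.exists_forall_near hd hsy hε4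
  obtain ⟨z, hsz, hz⟩ := ENNReal.lt_iff_exists_nnreal_btwn.1 (lt_min hsx hsy)
  rw [ENNReal.coe_lt_coe] at hsz
  obtain ⟨r, hsr, hr⟩ := exists_between (lt_min (lt_min hv hw) hsz)
  have hrz : (r : ℝ≥0∞) < z := ENNReal.coe_lt_coe.2 (hr.trans_le (min_le_right _ _))
  have hrx : (r : ℝ≥0∞) < x.xi := (hrz.trans hz).trans_le (min_le_left _ _)
  have hry : (r : ℝ≥0∞) < y.xi := (hrz.trans hz).trans_le (min_le_right _ _)
  have hrv : r < v := hr.trans_le ((min_le_left _ _).trans (min_le_left _ _))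
  have hrw : r < w := hr.trans_le ((min_le_left _ _).trans (min_le_right _ _))
  obtain ⟨hlim, hnear⟩ := hm.near_of_tendsto hry (hl.tendsto r hrx)
  obtain ⟨k, hk1, hk2, hk3, hk4⟩ := ((hl.near r hrx _ hε4).and ((hnear _ hε4).and
    ((hlim.eventually (lt_mem_nhds hsr)).and (hlim.eventually (gt_mem_nhds hrw))))).exists
  have h1 := (((hxv r hsr hrv).trans hd (hk1 r le_rfl)).trans hd (hk2.symm hd)).trans hd
    ((hyw _ hk3 hk4).symm hd)
  rw [← ha, ← hb] at h1
  obtain ⟨a', b', haa, hbb, hab⟩ := h1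
  obtain rfl := OnePoint.coe_injective haa
  obtain rfl := OnePoint.coe_injective hbb
  linarith

/-- If `x` exploded first, at `T < ξ(y)`, it would coincide with `y` before `T` and so have
relatively compact range. The criterion then makes `u k` leave every compact set at times tending to
`T`, where `u k` is close to the values of `y` in a compact set. -/
theorem SupCriterion.xi_le [T2Space S] [LocallyCompactSpace S] (hd : IsMetricOf d)
    (hx : SupCriterion d x u) (hy : SupCriterion d y u) : y.xi ≤ x.xi := by
  by_contra! hlt
  obtain ⟨l, hl, hlT⟩ := hx.exists_tracks
  obtain ⟨m, hm, -⟩ := hy.exists_tracks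
  obtain ⟨T, hT⟩ : ∃ T : ℝ≥0, (T : ℝ≥0∞) = x.xi :=
    ⟨_, ENNReal.coe_toNNReal (hlt.trans_le le_top).ne⟩
  have hTy : (T : ℝ≥0∞) < y.xi := hT ▸ hlt
  obtain ⟨v, hTv, hvy⟩ := ENNReal.lt_iff_exists_nnreal_btwn.1 hTy
  rw [ENNReal.coe_lt_coe] at hTv
  obtain ⟨K, hK, hyK⟩ := (y.isCadlagOn_Iic hvy).exists_isCompact
  have hrel : x.RelCompact := by
    refine hK.of_isClosed_subset isClosed_closure (closure_minimal ?_ hK.isClosed)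
    rintro a ⟨s, hs, hsa⟩
    have hsT : s < T := by
      rw [← hT] at hs
      exact_mod_cast hs
    rw [hl.val_eq hd hm hs (hs.trans hlt)] at hsa
    obtain ⟨b, hb, hbs⟩ := hyK s (hsT.trans hTv).le
    rw [hsa] at hbs
    exact OnePoint.coe_injective hbs ▸ hb
  obtain ⟨hlim, hout⟩ := hlT T hT.symm hrel
  obtain ⟨hlim', hnear⟩ := hm.near_of_tendsto hTy hlim
  obtain ⟨δ, hδ, K', hK', hKK'⟩ := exists_compact_thickening hd hK
  obtain ⟨k, hk1, hk2, hk3⟩ := ((hnear δ hδ).and ((hout K' hK').and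
    (hlim'.eventually (gt_mem_nhds hTv)))).exists
  obtain ⟨a, b, ha, hb, hab⟩ := hk1
  obtain ⟨a', ha', haa⟩ := hyK _ hk3.le
  obtain rfl := OnePoint.coe_injective (haa.trans ha)
  exact hk2 ⟨b, hKK' _ ha' b hab, hb.symm⟩

theorem SupCriterion.unique [T2Space S] [LocallyCompactSpace S] (hd : IsMetricOf d)
    (hx : SupCriterion d x u) (hy : SupCriterion d y u) : x = y := by
  have hxi : x.xi = y.xi := le_antisymm (hy.xi_le hd hx) (hx.xi_le hd hy)
  obtain ⟨l, hl, -⟩ := hx.exists_tracks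
  obtain ⟨m, hm, -⟩ := hy.exists_tracks
  refine LocPath.ext hxi (funext fun s => ?_)
  rcases lt_or_ge (s : ℝ≥0∞) x.xi with hs | hs
  · exact hl.val_eq hd hm hs (hxi ▸ hs)
  · rw [(x.val_eq_infty_iff s).2 hs, (y.val_eq_infty_iff s).2 (hxi ▸ hs)]

/-! ### Equivalence of the criteria and identification of the topology -/

section Main

variable [T2Space S] [LocallyCompactSpace S] [SecondCountableTopology S]

theorem logCriterion_iff_tendsto :
    LogCriterion d x u ↔ Tendsto u atTop (criterionFilter d lipTimeChanges logNorm x) :=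
  criterion_iff_tendsto ⟨_, refl_mem_lipTimeChanges⟩ logNorm_mono

theorem supCriterion_iff_tendsto :
    SupCriterion d x u ↔ Tendsto u atTop (criterionFilter d univ supNorm x) :=
  criterion_iff_tendsto univ_nonempty supNorm_mono

theorem logCriterion_iff_supCriterion (hd : IsMetricOf d) :
    LogCriterion d x u ↔ SupCriterion d x u := by
  rw [logCriterion_iff_tendsto, supCriterion_iff_tendsto]
  exact ⟨fun h => h.mono_right (criterionFilter_log_le_sup x),
    fun h => h.mono_right (criterionFilter_sup_le_log hd x)⟩

theorem tendsto_localSkorokhodTopology_iff (hd : IsMetricOf d) :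
    Tendsto u atTop (@nhds _ (localSkorokhodTopology d) x) ↔ LogCriterion d x u := by
  rw [logCriterion_iff_tendsto]
  refine tendsto_nhds_sequential_iff
    (pure_le_criterionFilter hd refl_mem_lipTimeChanges logNorm_refl) (fun v x y hx hy => ?_)
    (localSkorokhodTopology d) (fun U => ?_) u x
  · rw [← logCriterion_iff_tendsto, logCriterion_iff_supCriterion hd] at hx hy
    exact hx.unique hd hy
  · simp only [← logCriterion_iff_tendsto]
    exact Iff.rfl

end Main

end LocalSkorokhod

theorem theorem2 {S : Type*} [TopologicalSpace S] [T2Space S] [LocallyCompactSpace S]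
    [SecondCountableTopology S] (d d' : S → S → ℝ)
    (hd : LocalSkorokhod.IsMetricOf d) (hd' : LocalSkorokhod.IsMetricOf d') :
    (∀ (x : LocalSkorokhod.LocPath S) (xk : ℕ → LocalSkorokhod.LocPath S),
      (Tendsto xk atTop (@nhds _ (LocalSkorokhod.localSkorokhodTopology d) x) ↔
        LocalSkorokhod.LogCriterion d' x xk) ∧
      (Tendsto xk atTop (@nhds _ (LocalSkorokhod.localSkorokhodTopology d) x) ↔
        LocalSkorokhod.SupCriterion d' x xk)) ∧
    (∀ τ : TopologicalSpace (LocalSkorokhod.LocPath S),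
      @PolishSpace (LocalSkorokhod.LocPath S) τ →
      (∀ (x : LocalSkorokhod.LocPath S) (xk : ℕ → LocalSkorokhod.LocPath S),
        Tendsto xk atTop (@nhds _ τ x) ↔ LocalSkorokhod.SupCriterion d' x xk) →
      τ = LocalSkorokhod.localSkorokhodTopology d) := by

  -- The topology is built from `d` and the criteria use `d'`; the change of metric is made here,
  -- once, on the logarithmic criterion.
  have hlog : ∀ (x : LocalSkorokhod.LocPath S) (xk : ℕ → LocalSkorokhod.LocPath S),
      Tendsto xk atTop (@nhds _ (LocalSkorokhod.localSkorokhodTopology d) x) ↔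
        LocalSkorokhod.LogCriterion d' x xk :=
    fun x xk => (LocalSkorokhod.tendsto_localSkorokhodTopology_iff hd).trans
      ⟨fun h => h.of_metric hd hd', fun h => h.of_metric hd' hd⟩
  refine ⟨fun x xk => ⟨hlog x xk,
    (hlog x xk).trans (LocalSkorokhod.logCriterion_iff_supCriterion hd')⟩, fun τ hτ h => ?_⟩
  refine LocalSkorokhod.eq_localSkorokhodTopology d τ hτ fun x xk => (h x xk).trans ?_
  rw [← LocalSkorokhod.logCriterion_iff_supCriterion hd', ← hlog,
    LocalSkorokhod.tendsto_localSkorokhodTopology_iff hd]
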